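/- **Setting.** Let $n\ge 1$ and consider $\min_{w\in\mathbb R^p}\max_{u\in\mathbb R^q}\{f(w)+\frac1n\sum_{i=1}^n\langle F_i(w),Ku\rangle-h(u)\}$ with $F_i:\mathbb R^p\to\mathbb R^m$, $K\in\mathbb R^{m\times q}$, and $f,h$ with values in $\mathbb R\cup\{+\infty\}$. Put $F=\frac1n\sum_iF_i$, let $\|\cdot\|$ be the Euclidean norm of vectors and the operator norm of matrices, and assume: * $f$ is proper, closed and convex; $h$ is proper, closed and $\mu_h$-strongly convex with $\mu_h\ge0$, and $\|u\|\le M_h$ for all $u\in\operatorname{dom}h$; * $\Psi_0^\star:=\inf_w\Psi_0(w)>-\infty$, where $\Psi_0:=f+\Phi_0$ and $\Phi_0(w):=\max_u\{\langle F(w),Ku\rangle-h(u)\}$; * each $F_i$ is continuously differentiable and $M_{F_i}$-Lipschitz, its Jacobian $\nabla F_i$ is $L_{F_i}$-Lipschitz, and $\frac1n\sum_i\|\nabla F_i(w)-\nabla F(w)\|^2\le\sigma_J^2$ for all $w$, with $\sigma_J>0$. Put $M_F=\max_iM_{F_i}$, $L_F=\max_iL_{F_i}$. Let $b:\mathbb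 R^q\to\mathbb R\cup\{+\infty\}$ be proper, closed and $1$-strongly convex, with $\operatorname{dom}h\subseteq\operatorname{dom}b$ and $b$ bounded above on $\operatorname{dom}h$ (automatic if $b$ is real-valued); put $B:=\sup_{\operatorname{dom}h}b-\inf_{\operatorname{dom}h}b$. Let $\gamma\ge0$ with $\mu_h+\gamma>0$, $\Phi_\gamma(w):=\max_u\{\langle F(w),Ku\rangle-h(u)-\gamma b(u)\}$, $u_\gamma^\star(v):=\arg\max_u\{\langle v,Ku\rangle-h(u)-\gamma b(u)\}$, and, for $\eta>0$, $\mathcal G_\eta(w):=\eta^{-1}(w-\mathrm{prox}_{\eta f}(w-\eta\nabla\Phi_\gamma(w)))$. Let $\Lambda_0\ge1$, $\Lambda_1\ge0$, and $$Q_\gamma:=\frac{M_F^2\|K\|^2}{\mu_h+\gamma}+M_hL_F\|K\|.$$ Assume $Q_\gamma>0$ and $4M_h^2\|K\|^2\sigma_J^2+\Lambda_1>0$, so that the formulas below make sense. **Algorithm.** Start from $\widetilde w_0\in\operatorname{dom}f$. In epoch $t=1,2,\dots$ put $w_0^{(t)}=\widetilde w_{t-1}$, take permutations $\pi^{(t)},\hat\pi^{(t)}$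 of $\{1,\dots,n\}$, and for $i=1,\dots,n$ put $$w_i^{(t)}=w_{i-1}^{(t)}-\tfrac{\eta}{n}\,\nabla F_{\hat\pi^{(t)}(i)}(w_{i-1}^{(t)})^\top K\,u_\gamma^\star(F_i^{(t)}),$$ where either (Option 1) $F_i^{(t)}=\frac1n\big[\sum_{j\le i}F_{\pi^{(t)}(j)}(w_{j-1}^{(t)})+\sum_{j>i}F_{\pi^{(t)}(j)}(w_0^{(t)})\big]$ throughout, or (Option 2) $F_i^{(t)}=F(w_0^{(t)})$ throughout. Then put $\widetilde w_t=\mathrm{prox}_{\eta f}(w_n^{(t)})$. **Claim.** Let $\epsilon>0$. For either option the following hold. (a) Let the permutations be arbitrary, let $$\eta=\frac{\epsilon}{8Q_\gamma\sqrt{4M_h^2\|K\|^2\sigma_J^2+\Lambda_1}},\qquad T\ge\left\lfloor\frac{64\,Q_\gamma\sqrt{4M_h^2\|K\|^2\sigma_J^2+\Lambda_1}\,[\Psi_0(\widetilde w_0)-\Psi_0^\star+\gamma B]}{\epsilon^3}\right\rfloor,$$ let $\epsilon$ be so small that $\eta\le\frac1{8Q_\gamma\sqrt{\Lambda_0}}$,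 and suppose that, for this $\eta$, $$\|\nabla\Phi_\gamma(w)\|^2\le\Lambda_0\|\mathcal G_\eta(w)\|^2+\Lambda_1\quad\text{for all } w\in\operatorname{dom}f.\tag{1}$$ Then $\frac1{T+1}\sum_{t=0}^T\|\mathcal G_\eta(\widetilde w_t)\|^2\le\epsilon^2$. (b) Let all the permutations $\pi^{(t)},\hat\pi^{(t)}$, $t\ge1$, be uniformly random and mutually independent, let $$\eta=\frac{\sqrt n\,\epsilon}{8Q_\gamma\sqrt{4M_h^2\|K\|^2\sigma_J^2+n\Lambda_1}},\qquad T\ge\left\lfloor\frac{64\,Q_\gamma\sqrt{4M_h^2\|K\|^2\sigma_J^2+n\Lambda_1}\,[\Psi_0(\widetilde w_0)-\Psi_0^\star+\gamma B]}{\sqrt n\,\epsilon^3}\right\rfloor,$$ let $\epsilon$ be so small that $\eta\le\frac1{8Q_\gamma\sqrt{\Lambda_0}}$, and suppose that (1) holds for this $\eta$. Then every $\|\mathcal G_\eta(\widetilde w_t)\|^2$ is integrable and $\frac1{T+1}\sum_{t=0}^T\mathbb E\big[\|\mathcal G_\eta(\widetilde w_t)\|^2\big]\le\epsilon^2$. So,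 for fixed $\gamma$, $\eta=\Theta(\epsilon)$ and $T=O(\epsilon^{-3})$ epochs suffice in (a), and, when $\Lambda_1=O(1/n)$, $\eta=\Theta(\sqrt n\,\epsilon)$ and $T=O(n^{-1/2}\epsilon^{-3})$ epochs suffice in (b). -/

import Mathlib

open scoped NNReal InnerProductSpace
open MeasureTheory ProbabilityTheory

noncomputable section

namespace NLShuffle

/-- The Euclidean space `ℝᵈ`. -/
abbrev Euc (d : ℕ) : Type := EuclideanSpace ℝ (Fin d)

section Convex

variable {d : ℕ}

/-- Effective domain of an extended-real-valued function. -/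
def effDom (g : Euc d → EReal) : Set (Euc d) := {x | g x ≠ ⊤}

/-- `g : ℝᵈ → ℝ ∪ {+∞}` is proper, closed (lower semicontinuous) and `μ`-strongly convex;
for `μ = 0` this is proper, closed and convex. -/
structure IsProperClosedStrongConvex (μ : ℝ) (g : Euc d → EReal) : Prop where
  ne_bot : ∀ x, g x ≠ ⊥
  dom_nonempty : (effDom g).Nonempty
  closed : LowerSemicontinuous g
  strongConvex : StrongConvexOn (effDom g) μ (fun x => (g x).toReal)

/-- A minimizer of `g` over `ℝᵈ` (an arbitrary point if there is none). -/
def argMin (g : Euc d → EReal) : Euc d :=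
  Classical.epsilon fun x => ∀ y, g x ≤ g y

/-- The proximal operator of `η g`, as the minimizer of `y ↦ g y + ‖y - x‖² / (2 η)`. -/
def prox (η : ℝ) (g : Euc d → EReal) (x : Euc d) : Euc d :=
  argMin fun y => g y + ((1 / (2 * η) * ‖y - x‖ ^ 2 : ℝ) : EReal)

end Convex

/-- The data of the problem
`min_w max_u f(w) + (1/n) ∑ᵢ ⟨Fᵢ(w), K u⟩ - h(u)`, together with the prox-function `b`
that is used for smoothing. -/
structure Data (n p q m : ℕ) where
  F : Fin n → Euc p → Euc m
  K : Euc q →L[ℝ] Euc m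
  f : Euc p → EReal
  h : Euc q → EReal
  b : Euc q → EReal

namespace Data

variable {n p q m : ℕ} (P : Data n p q m)

/-- The average `F = (1/n) ∑ᵢ Fᵢ`. -/
def Favg (w : Euc p) : Euc m := (1 / (n : ℝ)) • ∑ i, P.F i w

/-- The value `max_u ⟨v, K u⟩ - g(u)`. -/
def maxVal (g : Euc q → EReal) (v : Euc m) : EReal :=
  ⨆ u, (((⟪v, P.K u⟫_ℝ : ℝ) : EReal) - g u)

/-- The function `h + γ b`. -/
def hSmooth (γ : ℝ) (u : Euc q) : EReal := P.h u + (γ : EReal) * P.b u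

/-- `Φ₀(w) = max_u ⟨F(w), K u⟩ - h(u)`. -/
def Phi0 (w : Euc p) : EReal := P.maxVal P.h (P.Favg w)

/-- `Ψ₀ = f + Φ₀`. -/
def Psi0 (w : Euc p) : EReal := P.f w + P.Phi0 w

/-- The optimal value `Ψ₀⋆ = inf_w Ψ₀(w)`. -/
def Psi0Star : EReal := ⨅ w, P.Psi0 w

/-- `Φ_γ(w) = max_u ⟨F(w), K u⟩ - h(u) - γ b(u)`. -/
def PhiSmooth (γ : ℝ) (w : Euc p) : EReal := P.maxVal (P.hSmooth γ) (P.Favg w)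

/-- `u_γ^⋆(v)`, the maximizer of `u ↦ ⟨v, K u⟩ - h(u) - γ b(u)`. -/
def uStar (γ : ℝ) (v : Euc m) : Euc q :=
  argMin fun u => P.hSmooth γ u - ((⟪v, P.K u⟫_ℝ : ℝ) : EReal)

/-- The hyper-gradient `∇Φ_γ`. -/
def gradPhi (γ : ℝ) (w : Euc p) : Euc p :=
  gradient (fun x => (P.PhiSmooth γ x).toReal) w

/-- The gradient mapping `𝒢_η(w) = (w - prox_{ηf}(w - η ∇Φ_γ(w))) / η` of `f + Φ_γ`. -/
def gradMap (γ η : ℝ) (w : Euc p) : Euc p :=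
  η⁻¹ • (w - prox η P.f (w - η • P.gradPhi γ w))

/-- Oscillation `sup b - inf b` of the prox-function over `dom h`. -/
def oscB : ℝ :=
  sSup ((fun u => (P.b u).toReal) '' effDom P.h) - sInf ((fun u => (P.b u).toReal) '' effDom P.h)

/-- Standing assumptions on the problem. The norm of a Jacobian is the operator norm. -/
structure Assumptions (μh Mh σJ : ℝ) (MF LF : Fin n → ℝ≥0) : Prop where
  f_convex : IsProperClosedStrongConvex 0 P.f
  muh_nonneg : 0 ≤ μh
  h_convex : IsProperClosedStrongConvex μh P.h
  h_dom_bounded : ∀ u ∈ effDom P.h, ‖u‖ ≤ Mh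
  psi0_bddBelow : P.Psi0Star ≠ ⊥
  F_contDiff : ∀ i, ContDiff ℝ 1 (P.F i)
  jac_lipschitz : ∀ i, LipschitzWith (LF i) (fderiv ℝ (P.F i))
  F_lipschitz : ∀ i, LipschitzWith (MF i) (P.F i)
  sigma_pos : 0 < σJ
  variance : ∀ w, (1 / (n : ℝ)) * ∑ i, ‖fderiv ℝ (P.F i) w - fderiv ℝ P.Favg w‖ ^ 2 ≤ σJ ^ 2

/-- `b` is an admissible prox-function. -/
structure IsProxFunction : Prop where
  convex : IsProperClosedStrongConvex 1 P.b
  dom_subset : effDom P.h ⊆ effDom P.b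
  bddAbove : BddAbove ((fun u => (P.b u).toReal) '' effDom P.h)

/-- `‖∇Φ_γ(w)‖² ≤ Λ₀ ‖𝒢_η(w)‖² + Λ₁` for all `w` in `dom Ψ₀ = dom f`. -/
def GradMapBound (γ η Λ0 Λ1 : ℝ) : Prop :=
  ∀ w ∈ effDom P.f, ‖P.gradPhi γ w‖ ^ 2 ≤ Λ0 * ‖P.gradMap γ η w‖ ^ 2 + Λ1

/-- `Q_γ = M_F² ‖K‖² / (μ_h + γ) + M_h L_F ‖K‖`, with `M_F = maxᵢ M_{Fᵢ}`, `L_F = maxᵢ L_{Fᵢ}`. -/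
def Q (μh Mh γ : ℝ) (MF LF : Fin n → ℝ≥0) : ℝ :=
  ((Finset.univ.sup MF : ℝ≥0) : ℝ) ^ 2 * ‖P.K‖ ^ 2 / (μh + γ)
    + Mh * ((Finset.univ.sup LF : ℝ≥0) : ℝ) * ‖P.K‖

end Data

/-- The two options for estimating the value of `F` inside an epoch. -/
inductive FOption
  /-- use the inner iterates that are already available -/
  | updated
  /-- use the initial point of the epoch only -/
  | frozen

namespace Data

variable {n p q m : ℕ} (P : Data n p q m)

/-- The estimator of `F` at inner iteration `i` from the inner iterates `w`. Positions are counted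
from `0`, so that position `j` of the permutation goes with the iterate `w j`. -/
def Fest (o : FOption) (π : Equiv.Perm (Fin n)) (w : ℕ → Euc p) (i : Fin n) : Euc m :=
  match o with
  | .updated => (1 / (n : ℝ)) • ∑ j : Fin n, P.F (π j) (if j ≤ i then w j else w 0)
  | .frozen => (1 / (n : ℝ)) • ∑ j : Fin n, P.F j (w 0)

/-- The shuffling estimator of the hyper-gradient at inner iteration `i`:
`(∇F_{π̂(i)}(wᵢ))ᵀ K u_γ^⋆(Fᵢ)`. -/
def gradEst (γ : ℝ) (o : FOption) (π πh : Equiv.Perm (Fin n)) (w : ℕ → Euc p) (i : Fin n) :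
    Euc p :=
  (fderiv ℝ (P.F (πh i)) (w i)).adjoint (P.K (P.uStar γ (P.Fest o π w i)))

/-- The inner iterates of one epoch started at `w₀` (constant after step `n`). The estimator at
step `i` only sees the iterates up to `i`; see `inner_succ` for the resulting recursion. -/
def inner (γ η : ℝ) (o : FOption) (π πh : Equiv.Perm (Fin n)) (w₀ : Euc p) : ℕ → Euc p
  | 0 => w₀
  | i + 1 =>
    if hi : i < n then
      inner γ η o π πh w₀ i - (η / n) •
        P.gradEst γ o π πh
          (fun j => if _ : j ≤ i then inner γ η o π πh w₀ j else w₀) ⟨i, hi⟩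
    else inner γ η o π πh w₀ i
  termination_by i => i

theorem inner_zero (γ η : ℝ) (o : FOption) (π πh : Equiv.Perm (Fin n)) (w₀ : Euc p) :
    P.inner γ η o π πh w₀ 0 = w₀ := by
  rw [inner]

theorem inner_succ (γ η : ℝ) (o : FOption) (π πh : Equiv.Perm (Fin n)) (w₀ : Euc p)
    (i : Fin n) :
    P.inner γ η o π πh w₀ (i + 1) = P.inner γ η o π πh w₀ i
      - (η / n) • P.gradEst γ o π πh (P.inner γ η o π πh w₀) i := by
  have key : P.Fest o π
      (fun j => if _ : j ≤ (i : ℕ) then P.inner γ η o π πh w₀ j else w₀) i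
      = P.Fest o π (P.inner γ η o π πh w₀) i := by
    cases o with
    | updated =>
      simp only [Fest]
      congr 1
      refine Finset.sum_congr rfl fun j _ => ?_
      by_cases hj : j ≤ i
      · have hj' : (j : ℕ) ≤ (i : ℕ) := hj
        simp [hj, hj']
      · simp [hj]
    | frozen => simp [Fest]
  rw [inner]
  simp only [i.isLt, dif_pos, gradEst]
  rw [key]
  simp

/-- The outer iterates of the shuffling proximal gradient method with constant learning rate
`η`; epoch `t + 1` uses the permutations `π t` and `πh t`. -/
def iter (γ η : ℝ) (o : FOption) (π πh : ℕ → Equiv.Perm (Fin n)) (w₀ : Euc p) : ℕ → Euc p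
  | 0 => w₀
  | t + 1 => prox η P.f (P.inner γ η o (π t) (πh t) (iter γ η o π πh w₀ t) n)

end Data

/-- Every set of permutations is measurable. -/
instance instMeasurableSpacePerm (n : ℕ) : MeasurableSpace (Equiv.Perm (Fin n)) := ⊤

/-- All permutations `π t`, `πh t` (`t ∈ ℕ`) are uniformly distributed and mutually independent. -/
structure IsRandomShuffling {n : ℕ} {Ω : Type*} [MeasurableSpace Ω] (ρ : Measure Ω)
    (π πh : ℕ → Ω → Equiv.Perm (Fin n)) : Prop where
  measurable_left : ∀ t, Measurable (π t)
  measurable_right : ∀ t, Measurable (πh t)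
  uniform_left : ∀ t, ρ.map (π t) = uniformOn Set.univ
  uniform_right : ∀ t, ρ.map (πh t) = uniformOn Set.univ
  indep : iIndepFun (Sum.elim π πh) ρ

end NLShuffle

end

/-! No proximal step is taken inside an epoch, so its last inner iterate is `w - η s`, with `s` the
mean of the `n` estimators (`inner_last`): an epoch is one proximal gradient step on `f + Φ_γ` with
inexact gradient `s`. Strong convexity of `h + γ b` makes the dual maximizer Lipschitz, hence `∇Φ_γ`
is `Q_γ`-Lipschitz, and `prox_grad_step` yields a decrease of `η/2 ‖𝒢_η‖²` up to an error `η/2 ‖∇Φ_γ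
- s‖²`.

A permutation visits every component once, so the partial hyper-gradients at the start of the epoch
average exactly to `∇Φ_γ`. The error therefore comes only from the drift of the inner iterates: it
is at most `Q_γ²` times their mean squared drift (`estimator_error`). The drift is itself of order
`η² (V + ‖∇Φ_γ‖²)`, where `V` is the `partialSumSq` of the centred deviations of the partial
hyper-gradients (`epoch_dev_le`). Condition (1) trades `‖∇Φ_γ‖²` for `Λ₀ ‖𝒢_η‖² + Λ₁`, and the bound
on `η` lets the decrease absorb the first term (`epoch_descent`).

The two regimes differ only in `V`. Cauchy–Schwarz bounds it by half the variance for every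
permutation. For a uniform permutation, draws without replacement are negatively correlated and the
mean gains a factor `1/n`; the current `πh` is independent of the current iterate, so the iterate
may be frozen while averaging. The permutations `π` enter only through bounds valid for each of
them.

The decrease telescopes, at a cost `γ B` for passing from `Ψ₀` to the smoothed objective
(`psi_gap_le`). The choices of `η` and `T` make the initial gap and the noise contribute at most
`ε²/2` each. -/

noncomputable section

namespace NLShuffle

/-! ### Strongly convex extended-valued functions and proximal points -/

section Convex

variable {d : ℕ} {μ ν : ℝ} {g : Euc d → EReal}

theorem IsProperClosedStrongConvex.coe_toReal (hg : IsProperClosedStrongConvex μ g) {x : Euc d}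
    (hx : x ∈ effDom g) : ((g x).toReal : EReal) = g x :=
  EReal.coe_toReal hx (hg.ne_bot x)

theorem IsProperClosedStrongConvex.ineq (hg : IsProperClosedStrongConvex μ g) {x y : Euc d}
    (hx : x ∈ effDom g) (hy : y ∈ effDom g) {a b : ℝ} (ha : 0 ≤ a) (hb : 0 ≤ b) (hab : a + b = 1) :
    (g (a • x + b • y)).toReal
      ≤ a * (g x).toReal + b * (g y).toReal - a * b * (μ / 2 * ‖x - y‖ ^ 2) := by
  simpa using hg.strongConvex.2 hx hy ha hb hab

theorem IsProperClosedStrongConvex.add {k : Euc d → EReal} (hg : IsProperClosedStrongConvex μ g)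
    (hk : IsProperClosedStrongConvex ν k) (hsub : effDom g ⊆ effDom k) :
    IsProperClosedStrongConvex (μ + ν) (fun x => g x + k x) ∧
      effDom (fun x => g x + k x) = effDom g := by
  have hdom : effDom (fun x => g x + k x) = effDom g := by
    ext x
    constructor
    · intro h h'
      exact h (by simp [h', EReal.top_add_of_ne_bot (hk.ne_bot x)])
    · intro h
      exact EReal.add_ne_top h (hsub h)
  have hval : ∀ x ∈ effDom g, (g x + k x).toReal = (g x).toReal + (k x).toReal := fun x hx =>
    EReal.toReal_add hx (hg.ne_bot x) (hsub hx) (hk.ne_bot x)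
  refine ⟨⟨fun x => ?_, by rw [hdom]; exact hg.dom_nonempty, ?_, ?_⟩, hdom⟩
  · simp [EReal.add_eq_bot_iff, hg.ne_bot x, hk.ne_bot x]
  · exact hg.closed.add' hk.closed fun x =>
      EReal.continuousAt_add (Or.inr (hk.ne_bot x)) (Or.inl (hg.ne_bot x))
  · rw [hdom]
    refine ⟨hg.strongConvex.1, fun x hx y hy a b ha hb hab => ?_⟩
    have hz := hg.strongConvex.1 hx hy ha hb hab
    have h1 := hg.ineq hx hy ha hb hab
    have h2 := hk.ineq (hsub hx) (hsub hy) ha hb hab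
    simp only [hval _ hz, hval x hx, hval y hy, smul_eq_mul]
    linarith

theorem isProperClosedStrongConvex_coe {r : Euc d → ℝ} (hr : Continuous r)
    (hr' : StrongConvexOn Set.univ ν r) :
    IsProperClosedStrongConvex ν (fun x => (r x : EReal)) ∧
      effDom (fun x => (r x : EReal)) = Set.univ := by
  have hdom : effDom (fun x => (r x : EReal)) = Set.univ := by
    ext x; simp [effDom]
  refine ⟨⟨fun x => EReal.coe_ne_bot _, by rw [hdom]; exact Set.univ_nonempty,
    (continuous_coe_real_ereal.comp hr).lowerSemicontinuous, ?_⟩, hdom⟩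
  rw [hdom]
  simpa using hr'

theorem IsProperClosedStrongConvex.const_mul (hg : IsProperClosedStrongConvex μ g) {γ : ℝ}
    (hγ : 0 < γ) :
    IsProperClosedStrongConvex (γ * μ) (fun x => (γ : EReal) * g x) ∧
      effDom (fun x => (γ : EReal) * g x) = effDom g := by
  have hdom : effDom (fun x => (γ : EReal) * g x) = effDom g := by
    ext x
    constructor
    · intro h h'
      exact h (by simp [h', EReal.coe_mul_top_of_pos hγ])
    · intro h
      show (γ : EReal) * g x ≠ ⊤
      rw [← hg.coe_toReal h, ← EReal.coe_mul]
      exact EReal.coe_ne_top _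
  refine ⟨⟨fun x => ?_, by rw [hdom]; exact hg.dom_nonempty, ?_, ?_⟩, hdom⟩
  · intro h
    by_cases hx : x ∈ effDom g
    · rw [← hg.coe_toReal hx, ← EReal.coe_mul] at h
      exact EReal.coe_ne_bot _ h
    · have : g x = ⊤ := not_not.1 hx
      rw [this, EReal.coe_mul_top_of_pos hγ] at h
      exact top_ne_bot h
  · refine Continuous.comp_lowerSemicontinuous (g := fun y : EReal => (γ : EReal) * y) ?_
      hg.closed ?_
    · refine continuous_iff_continuousAt.2 fun y => ?_
      have hγ' : (γ : EReal) ≠ 0 := by exact_mod_cast hγ.ne'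
      exact (EReal.continuousAt_mul (p := ((γ : EReal), y)) (Or.inl hγ') (Or.inl hγ')
        (Or.inl (EReal.coe_ne_bot _)) (Or.inl (EReal.coe_ne_top _))).comp
        (by fun_prop : ContinuousAt (fun y : EReal => ((γ : EReal), y)) y)
    · exact fun y z hyz => mul_le_mul_of_nonneg_left hyz (by exact_mod_cast hγ.le)
  · rw [hdom]
    refine ⟨hg.strongConvex.1, fun x hx y hy a b ha hb hab => ?_⟩
    have h1 := mul_le_mul_of_nonneg_left (hg.ineq hx hy ha hb hab) hγ.le
    simp only [EReal.toReal_mul, EReal.toReal_coe, smul_eq_mul]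
    linarith

theorem IsProperClosedStrongConvex.bddBelow_on_compact (hg : IsProperClosedStrongConvex μ g)
    {s : Set (Euc d)} (hs : IsCompact s) : ∃ m : ℝ, ∀ x ∈ s, x ∈ effDom g → m ≤ (g x).toReal := by
  by_cases hne : s.Nonempty
  · obtain ⟨a, ha, hmin⟩ := LowerSemicontinuousOn.exists_isMinOn hne hs
      (hg.closed.lowerSemicontinuousOn s)
    -- If the minimal value is `⊤`, no point of `s` lies in the domain and the bound is vacuous.
    exact ⟨(g a).toReal, fun x hx hx' => EReal.toReal_le_toReal (hmin hx) (hg.ne_bot a) hx'⟩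
  · exact ⟨0, fun x hx => (hne ⟨x, hx⟩).elim⟩

/-- Lower semicontinuity gives a minimizer on a ball. Far from `x₀`, strong convexity along the
segment to `x₀`, applied at the point at distance 1 from `x₀`, turns a lower bound near `x₀` into
quadratic growth, so the ball contains a global minimizer. -/
theorem IsProperClosedStrongConvex.exists_min (hg : IsProperClosedStrongConvex μ g) (hμ : 0 < μ) :
    ∃ x, ∀ y, g x ≤ g y := by
  obtain ⟨x₀, hx₀⟩ := hg.dom_nonempty
  obtain ⟨m, hm⟩ := hg.bddBelow_on_compact (isCompact_closedBall x₀ 1)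
  set c := (g x₀).toReal - m with hc
  have hc0 : 0 ≤ c := by
    have := hm x₀ (by simp) hx₀
    linarith
  -- Chosen so that `r > R` forces `c ≤ (r - 1) μ / 2`, which is `h5` below.
  set R : ℝ := 1 + 2 * c / μ with hR
  have hR1 : 1 ≤ R := by rw [hR]; have := div_nonneg (mul_nonneg zero_le_two hc0) hμ.le; linarith
  obtain ⟨a, ha, hmin⟩ := LowerSemicontinuousOn.exists_isMinOn
    (s := Metric.closedBall x₀ R) ⟨x₀, by simp; linarith⟩ (isCompact_closedBall x₀ R)
    (hg.closed.lowerSemicontinuousOn _)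
  refine ⟨a, fun y => ?_⟩
  by_cases hy : y ∈ Metric.closedBall x₀ R
  · exact hmin hy
  refine (hmin (show x₀ ∈ Metric.closedBall x₀ R by simp; linarith)).trans ?_
  by_cases hyd : y ∈ effDom g
  swap
  · rw [not_not.1 hyd]; exact le_top
  rw [← hg.coe_toReal hx₀, ← hg.coe_toReal hyd, EReal.coe_le_coe_iff]
  set r := ‖x₀ - y‖ with hr
  have hrR : R < r := by
    rw [Metric.mem_closedBall, dist_comm, dist_eq_norm, not_le] at hy
    exact hy
  have hr0 : 0 < r := by linarith
  have hinv : r⁻¹ ≤ 1 := inv_le_one_of_one_le₀ (by linarith)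
  have hz := hg.strongConvex.1 hx₀ hyd (sub_nonneg.2 hinv) (inv_nonneg.2 hr0.le) (by ring)
  have h1 := hg.ineq hx₀ hyd (sub_nonneg.2 hinv) (inv_nonneg.2 hr0.le) (by ring)
  have h2 := hm _ (by
    rw [Metric.mem_closedBall, dist_eq_norm]
    have : (1 - r⁻¹) • x₀ + r⁻¹ • y - x₀ = -(r⁻¹ • (x₀ - y)) := by module
    rw [this, norm_neg, norm_smul, Real.norm_of_nonneg (inv_nonneg.2 hr0.le), ← hr,
      inv_mul_cancel₀ hr0.ne']) hz
  have h3 := h2.trans h1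
  have h4 : r * m ≤ (r - 1) * (g x₀).toReal + (g y).toReal - (r - 1) * (μ / 2 * r) := by
    have := mul_le_mul_of_nonneg_left h3 hr0.le
    refine this.trans (le_of_eq ?_)
    rw [← hr]
    field_simp
  have h5 : c ≤ (r - 1) * μ / 2 := by
    have : 2 * c / μ ≤ r - 1 := by linarith
    rw [div_le_iff₀ hμ] at this
    linarith
  nlinarith [mul_le_mul_of_nonneg_left h5 hr0.le]

theorem IsProperClosedStrongConvex.argMin_le (hg : IsProperClosedStrongConvex μ g) (hμ : 0 < μ)
    (y : Euc d) : g (argMin g) ≤ g y :=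
  Classical.epsilon_spec (hg.exists_min hμ) y

theorem IsProperClosedStrongConvex.argMin_mem (hg : IsProperClosedStrongConvex μ g) (hμ : 0 < μ) :
    argMin g ∈ effDom g := by
  obtain ⟨x₀, hx₀⟩ := hg.dom_nonempty
  exact ((hg.argMin_le hμ x₀).trans_lt (lt_top_iff_ne_top.2 hx₀)).ne

/-- Quadratic growth of a strongly convex function away from its minimizer. -/
theorem IsProperClosedStrongConvex.growth (hg : IsProperClosedStrongConvex μ g) (hμ : 0 < μ)
    {y : Euc d} (hy : y ∈ effDom g) :
    (g (argMin g)).toReal + μ / 2 * ‖argMin g - y‖ ^ 2 ≤ (g y).toReal := by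
  have hx := hg.argMin_mem hμ
  set x := argMin g with hxdef
  -- Minimality is tested at a convex combination and divided by `1 - a`; the leftover factor `a`
  -- then tends to 1.
  have key : ∀ a ∈ Set.Ioo (0 : ℝ) 1,
      (g x).toReal + a * (μ / 2 * ‖x - y‖ ^ 2) ≤ (g y).toReal := by
    intro a ha
    have hb : 0 < 1 - a := sub_pos.2 ha.2
    have h1 := hg.ineq hx hy ha.1.le hb.le (by ring)
    have hz := hg.strongConvex.1 hx hy ha.1.le hb.le (by ring)
    have h2 : (g x).toReal ≤ (g (a • x + (1 - a) • y)).toReal :=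
      EReal.toReal_le_toReal (hg.argMin_le hμ _) (hg.ne_bot _) hz
    have h3 := h2.trans h1
    refine le_of_mul_le_mul_left ?_ hb
    linarith
  have hlim : Filter.Tendsto (fun a : ℝ => (g x).toReal + a * (μ / 2 * ‖x - y‖ ^ 2))
      (nhdsWithin 1 (Set.Iio 1)) (nhds ((g x).toReal + 1 * (μ / 2 * ‖x - y‖ ^ 2))) :=
    (Continuous.tendsto (by fun_prop) 1).mono_left nhdsWithin_le_nhds
  rw [one_mul] at hlim
  exact le_of_tendsto hlim (Filter.eventually_of_mem (Ioo_mem_nhdsLT zero_lt_one) key)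

theorem strongConvexOn_linear {L : Euc d → ℝ} (hL : ∀ (x y : Euc d) (a b : ℝ),
    L (a • x + b • y) = a * L x + b * L y) : StrongConvexOn Set.univ 0 L := by
  refine ⟨convex_univ, fun x _ y _ a b _ _ _ => ?_⟩
  simp [hL]

theorem strongConvexOn_sq_dist (x : Euc d) (c : ℝ) :
    StrongConvexOn Set.univ (2 * c) (fun y => c * ‖y - x‖ ^ 2) := by
  refine ⟨convex_univ, fun y _ z _ a b _ _ hab => le_of_eq ?_⟩
  obtain rfl : b = 1 - a := by linarith
  have h1 : a • y + (1 - a) • z - x = a • (y - x) + (1 - a) • (z - x) := by module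
  have h2 : y - z = (y - x) - (z - x) := by module
  simp only [smul_eq_mul]
  rw [h1, h2, norm_add_sq_real, norm_sub_sq_real (y - x), norm_smul, norm_smul,
    real_inner_smul_left, real_inner_smul_right, mul_pow, mul_pow, Real.norm_eq_abs,
    Real.norm_eq_abs, sq_abs, sq_abs]
  ring

theorem prox_objective {f : Euc d → EReal} (hf : IsProperClosedStrongConvex 0 f) {η : ℝ}
    (x : Euc d) :
    IsProperClosedStrongConvex (1 / η)
      (fun y => f y + ((1 / (2 * η) * ‖y - x‖ ^ 2 : ℝ) : EReal)) ∧
      effDom (fun y => f y + ((1 / (2 * η) * ‖y - x‖ ^ 2 : ℝ) : EReal)) = effDom f := by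
  have h := isProperClosedStrongConvex_coe (r := fun y => 1 / (2 * η) * ‖y - x‖ ^ 2)
    (by fun_prop) (strongConvexOn_sq_dist x (1 / (2 * η)))
  have h' := hf.add h.1 (by rw [h.2]; exact Set.subset_univ _)
  refine ⟨?_, h'.2⟩
  have := h'.1
  have e : 0 + 2 * (1 / (2 * η)) = 1 / η := by
    rw [zero_add, one_div, mul_inv, one_div]; ring
  rwa [e] at this

theorem prox_mem {f : Euc d → EReal} (hf : IsProperClosedStrongConvex 0 f) {η : ℝ} (hη : 0 < η)
    (x : Euc d) : prox η f x ∈ effDom f := by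
  have h := prox_objective hf (η := η) x
  have := h.1.argMin_mem (one_div_pos.2 hη)
  rwa [h.2] at this

theorem prox_ineq {f : Euc d → EReal} (hf : IsProperClosedStrongConvex 0 f) {η : ℝ} (hη : 0 < η)
    (x : Euc d) {z : Euc d} (hz : z ∈ effDom f) :
    (f (prox η f x)).toReal + 1 / (2 * η) * ‖prox η f x - x‖ ^ 2
        + 1 / (2 * η) * ‖prox η f x - z‖ ^ 2
      ≤ (f z).toReal + 1 / (2 * η) * ‖z - x‖ ^ 2 := by
  have h := prox_objective hf (η := η) x
  have h1 := h.1.growth (one_div_pos.2 hη) (y := z) (by rw [h.2]; exact hz)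
  have h2 := prox_mem hf hη x
  have e : ∀ y ∈ effDom f, (f y + ((1 / (2 * η) * ‖y - x‖ ^ 2 : ℝ) : EReal)).toReal
      = (f y).toReal + 1 / (2 * η) * ‖y - x‖ ^ 2 := fun y hy => by
    rw [EReal.toReal_add hy (hf.ne_bot y) (EReal.coe_ne_top _) (EReal.coe_ne_bot _),
      EReal.toReal_coe]
  change (f (prox η f x) + ((1 / (2 * η) * ‖prox η f x - x‖ ^ 2 : ℝ) : EReal)).toReal
    + 1 / η / 2 * ‖prox η f x - z‖ ^ 2 ≤ _ at h1
  rw [e _ h2, e _ hz] at h1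
  have e2 : 1 / η / 2 = 1 / (2 * η) := by rw [div_div, mul_comm]
  rwa [e2] at h1

end Convex

namespace Data

variable {n p q m : ℕ} {P : Data n p q m}

/-! ### The dual maximizer and Danskin's formula -/

section Dual

variable {μ γ Mh : ℝ}

/-- The real-valued smoothed function `v ↦ max_u ⟨v, K u⟩ - h(u) - γ b(u)`. -/
def smoothVal (P : Data n p q m) (γ : ℝ) (v : Euc m) : ℝ :=
  ⟪v, P.K (P.uStar γ v)⟫_ℝ - (P.hSmooth γ (P.uStar γ v)).toReal

theorem dual_objective (hg : IsProperClosedStrongConvex μ (P.hSmooth γ)) (v : Euc m) :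
    IsProperClosedStrongConvex μ
      (fun u => P.hSmooth γ u - ((⟪v, P.K u⟫_ℝ : ℝ) : EReal)) ∧
      effDom (fun u => P.hSmooth γ u - ((⟪v, P.K u⟫_ℝ : ℝ) : EReal)) = effDom (P.hSmooth γ) := by
  have h := isProperClosedStrongConvex_coe (r := fun u => -⟪v, P.K u⟫_ℝ)
    (by fun_prop) (strongConvexOn_linear fun x y a b => by
      simp only [map_add, map_smul, inner_add_right, inner_smul_right, neg_add]
      ring)
  have h' := hg.add h.1 (by rw [h.2]; exact Set.subset_univ _)
  simpa only [add_zero, sub_eq_add_neg, EReal.coe_neg] using h'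

theorem uStar_mem (hg : IsProperClosedStrongConvex μ (P.hSmooth γ)) (hμ : 0 < μ) (v : Euc m) :
    P.uStar γ v ∈ effDom (P.hSmooth γ) := by
  have h := dual_objective hg v
  have := h.1.argMin_mem hμ
  rwa [h.2] at this

theorem uStar_growth (hg : IsProperClosedStrongConvex μ (P.hSmooth γ)) (hμ : 0 < μ) (v : Euc m)
    {u : Euc q} (hu : u ∈ effDom (P.hSmooth γ)) :
    ⟪v, P.K u⟫_ℝ - (P.hSmooth γ u).toReal + μ / 2 * ‖P.uStar γ v - u‖ ^ 2
      ≤ P.smoothVal γ v := by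
  have h := dual_objective hg v
  have h1 := h.1.growth hμ (y := u) (by rw [h.2]; exact hu)
  have e : ∀ y ∈ effDom (P.hSmooth γ),
      (P.hSmooth γ y - ((⟪v, P.K y⟫_ℝ : ℝ) : EReal)).toReal
      = (P.hSmooth γ y).toReal - ⟪v, P.K y⟫_ℝ := fun y hy => by
    rw [EReal.toReal_sub hy (hg.ne_bot y) (EReal.coe_ne_top _) (EReal.coe_ne_bot _),
      EReal.toReal_coe]
  change (P.hSmooth γ (P.uStar γ v) - ((⟪v, P.K (P.uStar γ v)⟫_ℝ : ℝ) : EReal)).toReal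
    + μ / 2 * ‖P.uStar γ v - u‖ ^ 2 ≤ _ at h1
  rw [e _ (uStar_mem hg hμ v), e _ hu] at h1
  rw [smoothVal]
  linarith

theorem maxVal_hSmooth (hg : IsProperClosedStrongConvex μ (P.hSmooth γ)) (hμ : 0 < μ)
    (v : Euc m) : P.maxVal (P.hSmooth γ) v = (P.smoothVal γ v : ℝ) := by
  apply le_antisymm
  · refine iSup_le fun u => ?_
    by_cases hu : u ∈ effDom (P.hSmooth γ)
    · rw [← hg.coe_toReal hu, ← EReal.coe_sub, EReal.coe_le_coe_iff]
      have := uStar_growth hg hμ v hu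
      have h2 : 0 ≤ μ / 2 * ‖P.uStar γ v - u‖ ^ 2 := by positivity
      linarith
    · rw [not_not.1 hu, EReal.sub_top]
      exact bot_le
  · refine le_trans (le_of_eq ?_) (le_iSup _ (P.uStar γ v))
    rw [smoothVal, EReal.coe_sub, hg.coe_toReal (uStar_mem hg hμ v)]

/-- Adding the two growth inequalities, each maximizer tested against the other, cancels the values
of `hSmooth` and leaves strong monotonicity. -/
theorem uStar_lipschitz (hg : IsProperClosedStrongConvex μ (P.hSmooth γ)) (hμ : 0 < μ)
    (v v' : Euc m) : ‖P.uStar γ v - P.uStar γ v'‖ ≤ ‖P.K‖ / μ * ‖v - v'‖ := by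
  have h1 := uStar_growth hg hμ v (uStar_mem hg hμ v')
  have h2 := uStar_growth hg hμ v' (uStar_mem hg hμ v)
  rw [norm_sub_rev] at h2
  unfold smoothVal at h1 h2
  set u := P.uStar γ v
  set u' := P.uStar γ v'
  have h3 : μ * ‖u - u'‖ ^ 2 ≤ ⟪v - v', P.K (u - u')⟫_ℝ := by
    simp only [map_sub, inner_sub_left, inner_sub_right]
    linarith
  have h4 : ⟪v - v', P.K (u - u')⟫_ℝ ≤ ‖v - v'‖ * (‖P.K‖ * ‖u - u'‖) :=
    (real_inner_le_norm _ _).trans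
      (mul_le_mul_of_nonneg_left (P.K.le_opNorm _) (norm_nonneg _))
  rw [div_mul_eq_mul_div, le_div_iff₀ hμ]
  rcases (norm_nonneg (u - u')).eq_or_lt with h0 | h0
  · rw [← h0, zero_mul]
    positivity
  · refine le_of_mul_le_mul_right ?_ h0
    linarith

/-- Danskin's theorem with a rate: using each maximizer as a competitor at the other point squeezes
the first-order remainder between `0` and `⟪v' - v, K (u' - u)⟫`, which is quadratic in `v' - v` by
`uStar_lipschitz`. -/
theorem hasGradientAt_smoothVal (hg : IsProperClosedStrongConvex μ (P.hSmooth γ)) (hμ : 0 < μ)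
    (v : Euc m) : HasGradientAt (P.smoothVal γ) (P.K (P.uStar γ v)) v := by
  rw [hasGradientAt_iff_hasFDerivAt]
  refine HasFDerivAt.of_isLittleO ?_
  have hO : (fun x' => P.smoothVal γ x' - P.smoothVal γ v
      - InnerProductSpace.toDual ℝ (Euc m) (P.K (P.uStar γ v)) (x' - v))
      =O[nhds v] fun x' => ‖x' - v‖ ^ 2 := by
    refine Asymptotics.IsBigO.of_bound (‖P.K‖ * (‖P.K‖ / μ)) (Filter.Eventually.of_forall ?_)
    intro v'
    have h1 := uStar_growth hg hμ v (uStar_mem hg hμ v')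
    have h2 := uStar_growth hg hμ v' (uStar_mem hg hμ v)
    have h3 := uStar_lipschitz hg hμ v' v
    have h4 : ⟪v' - v, P.K (P.uStar γ v' - P.uStar γ v)⟫_ℝ
        ≤ ‖P.K‖ * (‖P.K‖ / μ) * ‖v' - v‖ ^ 2 := by
      refine (real_inner_le_norm _ _).trans ?_
      refine (mul_le_mul_of_nonneg_left ((P.K.le_opNorm _).trans
        (mul_le_mul_of_nonneg_left h3 (norm_nonneg _))) (norm_nonneg _)).trans (le_of_eq (by ring))
    have h5 : 0 ≤ μ / 2 * ‖P.uStar γ v - P.uStar γ v'‖ ^ 2 := by positivity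
    have h6 : 0 ≤ μ / 2 * ‖P.uStar γ v' - P.uStar γ v‖ ^ 2 := by positivity
    rw [InnerProductSpace.toDual_apply_apply, real_inner_comm, Real.norm_eq_abs, Real.norm_eq_abs,
      abs_of_nonneg (sq_nonneg ‖v' - v‖)]
    simp only [map_sub, inner_sub_left, inner_sub_right] at h4 ⊢
    unfold smoothVal at h1 h2 ⊢
    rw [abs_le]
    constructor
    · have : 0 ≤ ‖P.K‖ * (‖P.K‖ / μ) * ‖v' - v‖ ^ 2 := by positivity
      linarith
    · linarith
  exact hO.trans_isLittleO (Asymptotics.isLittleO_pow_sub_sub v one_lt_two)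

end Dual

/-- The standing assumptions, with a smoothing parameter for which the dual problem is strongly
convex. -/
structure Regular (P : Data n p q m) (μh Mh σJ γ : ℝ) (MF LF : Fin n → ℝ≥0) : Prop where
  pos : 0 < n
  base : P.Assumptions μh Mh σJ MF LF
  proxFun : P.IsProxFunction
  gamma_nonneg : 0 ≤ γ
  mu_pos : 0 < μh + γ

/-- The partial hyper-gradient `∇Fᵢ(w)ᵀ K u_γ^⋆(v)`. -/
def gradTerm (P : Data n p q m) (γ : ℝ) (i : Fin n) (w : Euc p) (v : Euc m) : Euc p :=
  (fderiv ℝ (P.F i) w).adjoint (P.K (P.uStar γ v))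

/-! ### Lipschitz bounds for the hyper-gradient -/

namespace Regular

variable {μh Mh σJ γ : ℝ} {MF LF : Fin n → ℝ≥0}

theorem hSmooth_convex (R : P.Regular μh Mh σJ γ MF LF) :
    IsProperClosedStrongConvex (μh + γ) (P.hSmooth γ) ∧ effDom (P.hSmooth γ) = effDom P.h := by
  rcases R.gamma_nonneg.eq_or_lt with h0 | h0
  · subst h0
    -- In `EReal`, `0 * ⊤ = 0`, so `b` disappears even outside its domain.
    have : P.hSmooth 0 = P.h := by
      funext u
      simp [hSmooth]
    rw [this, add_zero]
    exact ⟨R.base.h_convex, rfl⟩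
  · have h1 := R.proxFun.convex.const_mul h0
    have h2 := R.base.h_convex.add h1.1 (by rw [h1.2]; exact R.proxFun.dom_subset)
    rw [mul_one] at h2
    exact h2

theorem n_pos (R : P.Regular μh Mh σJ γ MF LF) : (0 : ℝ) < n := Nat.cast_pos.2 R.pos

theorem Mh_nonneg (R : P.Regular μh Mh σJ γ MF LF) : 0 ≤ Mh := by
  obtain ⟨u, hu⟩ := R.base.h_convex.dom_nonempty
  exact (norm_nonneg u).trans (R.base.h_dom_bounded u hu)

theorem uStar_mem (R : P.Regular μh Mh σJ γ MF LF) (v : Euc m) : P.uStar γ v ∈ effDom P.h := by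
  rw [← R.hSmooth_convex.2]
  exact Data.uStar_mem R.hSmooth_convex.1 R.mu_pos v

theorem norm_K_uStar_le (R : P.Regular μh Mh σJ γ MF LF) (v : Euc m) :
    ‖P.K (P.uStar γ v)‖ ≤ ‖P.K‖ * Mh :=
  (P.K.le_opNorm _).trans
    (mul_le_mul_of_nonneg_left (R.base.h_dom_bounded _ (R.uStar_mem v)) (norm_nonneg _))

theorem norm_fderiv_le (R : P.Regular μh Mh σJ γ MF LF) (i : Fin n) (w : Euc p) :
    ‖fderiv ℝ (P.F i) w‖ ≤ ((Finset.univ.sup MF : ℝ≥0) : ℝ) :=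
  (norm_fderiv_le_of_lipschitz ℝ (R.base.F_lipschitz i)).trans
    (by exact_mod_cast Finset.le_sup (f := MF) (Finset.mem_univ i))

theorem norm_F_sub_le (R : P.Regular μh Mh σJ γ MF LF) (i : Fin n) (w w' : Euc p) :
    ‖P.F i w - P.F i w'‖ ≤ ((Finset.univ.sup MF : ℝ≥0) : ℝ) * ‖w - w'‖ :=
  ((R.base.F_lipschitz i).norm_sub_le w w').trans (mul_le_mul_of_nonneg_right
    (by exact_mod_cast Finset.le_sup (f := MF) (Finset.mem_univ i)) (norm_nonneg _))

theorem norm_fderiv_sub_le (R : P.Regular μh Mh σJ γ MF LF) (i : Fin n) (w w' : Euc p) :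
    ‖fderiv ℝ (P.F i) w - fderiv ℝ (P.F i) w'‖
      ≤ ((Finset.univ.sup LF : ℝ≥0) : ℝ) * ‖w - w'‖ :=
  ((R.base.jac_lipschitz i).norm_sub_le w w').trans (mul_le_mul_of_nonneg_right
    (by exact_mod_cast Finset.le_sup (f := LF) (Finset.mem_univ i)) (norm_nonneg _))

/-- The Jacobian and the dual maximizer are varied one at a time. When `v` itself moves at most
`M_F` times as fast as `w`, the two coefficients combine to `Q_γ`. -/
theorem gradTerm_sub_le (R : P.Regular μh Mh σJ γ MF LF) (i : Fin n) (w w' : Euc p)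
    (v v' : Euc m) :
    ‖P.gradTerm γ i w v - P.gradTerm γ i w' v'‖
      ≤ Mh * ((Finset.univ.sup LF : ℝ≥0) : ℝ) * ‖P.K‖ * ‖w - w'‖
        + ((Finset.univ.sup MF : ℝ≥0) : ℝ) * ‖P.K‖ ^ 2 / (μh + γ) * ‖v - v'‖ := by
  have e : P.gradTerm γ i w v - P.gradTerm γ i w' v'
      = (fderiv ℝ (P.F i) w - fderiv ℝ (P.F i) w').adjoint (P.K (P.uStar γ v))
        + (fderiv ℝ (P.F i) w').adjoint (P.K (P.uStar γ v - P.uStar γ v')) := by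
    simp [gradTerm]
  rw [e]
  refine (norm_add_le _ _).trans (add_le_add ?_ ?_)
  · refine (ContinuousLinearMap.le_opNorm _ _).trans ?_
    rw [LinearIsometryEquiv.norm_map]
    refine (mul_le_mul (R.norm_fderiv_sub_le i w w') (R.norm_K_uStar_le v) (norm_nonneg _)
      (by positivity)).trans (le_of_eq (by ring))
  · refine (ContinuousLinearMap.le_opNorm _ _).trans ?_
    rw [LinearIsometryEquiv.norm_map]
    refine (mul_le_mul (R.norm_fderiv_le i w') ((P.K.le_opNorm _).trans
      (mul_le_mul_of_nonneg_left (uStar_lipschitz R.hSmooth_convex.1 R.mu_pos v v')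
        (norm_nonneg _))) (norm_nonneg _)
      (by positivity)).trans (le_of_eq (by ring))

theorem hasFDerivAt_F (R : P.Regular μh Mh σJ γ MF LF) (i : Fin n) (w : Euc p) :
    HasFDerivAt (P.F i) (fderiv ℝ (P.F i) w) w :=
  ((R.base.F_contDiff i).differentiable one_ne_zero w).hasFDerivAt

theorem hasFDerivAt_Favg (R : P.Regular μh Mh σJ γ MF LF) (w : Euc p) :
    HasFDerivAt P.Favg ((1 / (n : ℝ)) • ∑ i, fderiv ℝ (P.F i) w) w := by
  have := (HasFDerivAt.fun_sum (u := Finset.univ) fun i _ => R.hasFDerivAt_F i w).const_smul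
    (1 / (n : ℝ))
  exact this

theorem toReal_PhiSmooth (R : P.Regular μh Mh σJ γ MF LF) (w : Euc p) :
    (P.PhiSmooth γ w).toReal = P.smoothVal γ (P.Favg w) := by
  rw [PhiSmooth, maxVal_hSmooth R.hSmooth_convex.1 R.mu_pos, EReal.toReal_coe]

theorem hasGradientAt_Phi (R : P.Regular μh Mh σJ γ MF LF) (w : Euc p) :
    HasGradientAt (fun x => P.smoothVal γ (P.Favg x))
      ((1 / (n : ℝ)) • ∑ i, P.gradTerm γ i w (P.Favg w)) w := by
  have h1 := hasGradientAt_smoothVal R.hSmooth_convex.1 R.mu_pos (P.Favg w)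
  rw [hasGradientAt_iff_hasFDerivAt] at h1 ⊢
  refine (h1.comp w (R.hasFDerivAt_Favg w)).congr_fderiv ?_
  ext x
  simp only [ContinuousLinearMap.comp_apply, InnerProductSpace.toDual_apply_apply, gradTerm,
    smul_apply, sum_apply, inner_smul_left,
    inner_smul_right, sum_inner, inner_sum, ContinuousLinearMap.adjoint_inner_left]
  simp

theorem gradPhi_eq (R : P.Regular μh Mh σJ γ MF LF) (w : Euc p) :
    P.gradPhi γ w = (1 / (n : ℝ)) • ∑ i, P.gradTerm γ i w (P.Favg w) := by
  rw [gradPhi]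
  simp only [R.toReal_PhiSmooth]
  exact (R.hasGradientAt_Phi w).gradient

theorem norm_avg_le (R : P.Regular μh Mh σJ γ MF LF) {E : Type*} [NormedAddCommGroup E]
    [NormedSpace ℝ E] {x : Fin n → E} {c : ℝ} (hx : ∀ i, ‖x i‖ ≤ c) :
    ‖(1 / (n : ℝ)) • ∑ i, x i‖ ≤ c := by
  have hn := R.n_pos
  rw [norm_smul, Real.norm_of_nonneg (by positivity), one_div, inv_mul_le_iff₀ hn]
  refine (norm_sum_le _ _).trans ((Finset.sum_le_sum fun i _ => hx i).trans ?_)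
  simp

theorem norm_Favg_sub_le (R : P.Regular μh Mh σJ γ MF LF) (w w' : Euc p) :
    ‖P.Favg w - P.Favg w'‖ ≤ ((Finset.univ.sup MF : ℝ≥0) : ℝ) * ‖w - w'‖ := by
  rw [Favg, Favg, ← smul_sub, ← Finset.sum_sub_distrib]
  exact R.norm_avg_le fun i => R.norm_F_sub_le i w w'

theorem gradPhi_lipschitz (R : P.Regular μh Mh σJ γ MF LF) (w w' : Euc p) :
    ‖P.gradPhi γ w - P.gradPhi γ w'‖ ≤ P.Q μh Mh γ MF LF * ‖w - w'‖ := by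
  rw [R.gradPhi_eq, R.gradPhi_eq, ← smul_sub, ← Finset.sum_sub_distrib]
  refine R.norm_avg_le fun i => (R.gradTerm_sub_le i w w' _ _).trans ?_
  have hμ := R.mu_pos
  refine (add_le_add_right (mul_le_mul_of_nonneg_left (R.norm_Favg_sub_le w w')
    (by positivity)) _).trans (le_of_eq ?_)
  rw [Q]
  ring

end Regular

end Data

/-! ### Descent lemma and the inexact proximal gradient step -/

section Descent

variable {d : ℕ} {φ : Euc d → ℝ} {φ' : Euc d → Euc d} {Q : ℝ}

/-- The descent lemma for functions with Lipschitz gradient. -/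
theorem descent_upper (hφ : ∀ x, HasGradientAt φ (φ' x) x)
    (hlip : ∀ x y, ‖φ' x - φ' y‖ ≤ Q * ‖x - y‖) (x y : Euc d) :
    φ y ≤ φ x + ⟪φ' x, y - x⟫_ℝ + Q / 2 * ‖y - x‖ ^ 2 := by
  set e := y - x with he
  have hd : ∀ t : ℝ, HasDerivAt (fun t : ℝ => φ (x + t • e) - t * ⟪φ' x, e⟫_ℝ
      - Q / 2 * ‖e‖ ^ 2 * t ^ 2)
      (⟪φ' (x + t • e), e⟫_ℝ - ⟪φ' x, e⟫_ℝ - Q / 2 * ‖e‖ ^ 2 * (2 * t)) t := by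
    intro t
    have h1 : HasDerivAt (fun t : ℝ => x + t • e) e t := by
      simpa using ((hasDerivAt_id t).smul_const e).const_add x
    have h2 := (hasGradientAt_iff_hasFDerivAt.1 (hφ (x + t • e))).comp_hasDerivAt t h1
    have h3 : HasDerivAt (fun t : ℝ => t * ⟪φ' x, e⟫_ℝ) ⟪φ' x, e⟫_ℝ t := by
      simpa using (hasDerivAt_id t).mul_const ⟪φ' x, e⟫_ℝ
    have h4 : HasDerivAt (fun t : ℝ => Q / 2 * ‖e‖ ^ 2 * t ^ 2) (Q / 2 * ‖e‖ ^ 2 * (2 * t)) t := by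
      simpa using (hasDerivAt_pow 2 t).const_mul (Q / 2 * ‖e‖ ^ 2)
    exact (h2.sub h3).sub h4
  -- The derivative is nonpositive by Cauchy–Schwarz and the Lipschitz bound; the claim compares the
  -- endpoints `0` and `1`.
  have hanti : AntitoneOn (fun t : ℝ => φ (x + t • e) - t * ⟪φ' x, e⟫_ℝ
      - Q / 2 * ‖e‖ ^ 2 * t ^ 2) (Set.Icc 0 1) := by
    refine antitoneOn_of_deriv_nonpos (convex_Icc 0 1)
      (fun t _ => (hd t).continuousAt.continuousWithinAt)
      (fun t _ => (hd t).differentiableAt.differentiableWithinAt) fun t ht => ?_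
    rw [interior_Icc] at ht
    rw [(hd t).deriv, ← inner_sub_left]
    have h1 := (real_inner_le_norm (φ' (x + t • e) - φ' x) e).trans
      (mul_le_mul_of_nonneg_right (hlip (x + t • e) x) (norm_nonneg e))
    rw [add_sub_cancel_left, norm_smul, Real.norm_of_nonneg ht.1.le] at h1
    linarith
  have h := hanti (Set.left_mem_Icc.2 zero_le_one) (Set.right_mem_Icc.2 zero_le_one) zero_le_one
  simp only [zero_smul, one_smul, add_zero] at h
  rw [he, add_sub_cancel, ← he] at h
  linarith

/-- One step of the proximal gradient method with an inexact gradient `s`. -/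
theorem prox_grad_step (hφ : ∀ x, HasGradientAt φ (φ' x) x)
    (hlip : ∀ x y, ‖φ' x - φ' y‖ ≤ Q * ‖x - y‖) {f : Euc d → EReal}
    (hf : IsProperClosedStrongConvex 0 f) {η : ℝ} (hη : 0 < η) (hηQ : η * Q ≤ 1)
    {x : Euc d} (hx : x ∈ effDom f) (s : Euc d) :
    (f (prox η f (x - η • s))).toReal + φ (prox η f (x - η • s))
        + 1 / (2 * η) * ‖x - prox η f (x - η • φ' x)‖ ^ 2
      ≤ (f x).toReal + φ x + η / 2 * ‖φ' x - s‖ ^ 2 := by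
  set y := prox η f (x - η • s) with hy
  set z := prox η f (x - η • φ' x) with hz
  have hzm : z ∈ effDom f := prox_mem hf hη _
  -- The exact step `z` is an intermediary: `y` is tested against `z`, and `z` against `x`. Then `f
  -- z` cancels, and one of the two copies of `‖z - x‖²` in `h2` survives as the gradient mapping
  -- term.
  have h1 := prox_ineq hf hη (x - η • s) hzm
  have h2 := prox_ineq hf hη (x - η • φ' x) hx
  rw [← hy] at h1
  rw [← hz] at h2
  have d1 := descent_upper hφ hlip x y
  have expand : ∀ a g : Euc d, 1 / (2 * η) * ‖a - (x - η • g)‖ ^ 2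
      = 1 / (2 * η) * ‖a - x‖ ^ 2 + ⟪g, a - x⟫_ℝ + η / 2 * ‖g‖ ^ 2 := by
    intro a g
    have : a - (x - η • g) = (a - x) + η • g := by abel
    rw [this, norm_add_sq_real, real_inner_smul_right, norm_smul, Real.norm_of_nonneg hη.le,
      real_inner_comm]
    field_simp
  rw [expand, expand] at h1
  rw [expand, expand, sub_self, norm_zero, inner_zero_right] at h2
  -- Young's inequality, weighted so that `‖y - z‖²` is exactly cancelled by the growth term of
  -- `h1`.
  have hyz : ⟪φ' x - s, y - z⟫_ℝ ≤ 1 / (2 * η) * ‖y - z‖ ^ 2 + η / 2 * ‖φ' x - s‖ ^ 2 := by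
    refine (real_inner_le_norm _ _).trans ?_
    have := sq_nonneg (‖y - z‖ - η * ‖φ' x - s‖)
    have h0 : 0 ≤ 1 / (2 * η) * (‖y - z‖ - η * ‖φ' x - s‖) ^ 2 := by positivity
    have e : 1 / (2 * η) * (‖y - z‖ - η * ‖φ' x - s‖) ^ 2
        = 1 / (2 * η) * ‖y - z‖ ^ 2 + η / 2 * ‖φ' x - s‖ ^ 2 - ‖φ' x - s‖ * ‖y - z‖ := by
      field_simp
      ring
    linarith
  have e1 : ⟪φ' x - s, y - z⟫_ℝ = ⟪φ' x, y - x⟫_ℝ - ⟪φ' x, z - x⟫_ℝ - ⟪s, y - x⟫_ℝ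
      + ⟪s, z - x⟫_ℝ := by
    simp only [inner_sub_left, inner_sub_right]
    ring
  have hQη : 0 ≤ 1 / (2 * η) - Q / 2 := by
    rw [sub_nonneg, div_le_div_iff₀ two_pos (by positivity)]
    linarith
  have h7 : 0 ≤ (1 / (2 * η) - Q / 2) * ‖y - x‖ ^ 2 := mul_nonneg hQη (sq_nonneg _)
  rw [norm_sub_rev x z]
  linarith

end Descent

/-! ### Partial sums along a permutation -/

section Shuffle

variable {n : ℕ} {E : Type*} [NormedAddCommGroup E]

/-- The normalized sum of the squared partial sums of `x` along the permutation `σ`. -/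
def partialSumSq (x : Fin n → E) (σ : Equiv.Perm (Fin n)) : ℝ :=
  1 / (n : ℝ) ^ 3 * ∑ k : Fin n, ‖∑ i ∈ Finset.univ.filter fun i : Fin n => (i : ℕ) < k, x (σ i)‖ ^ 2

theorem sum_fin_le (n : ℕ) : ∑ k : Fin n, (k : ℝ) ≤ (n : ℝ) ^ 2 / 2 := by
  rw [Fin.sum_univ_eq_sum_range (fun k => (k : ℝ)) n]
  induction n with
  | zero => simp
  | succ k ih =>
    rw [Finset.sum_range_succ]
    push_cast
    linarith

theorem sum_fin_sq_le (n : ℕ) : ∑ k : Fin n, (k : ℝ) ^ 2 ≤ (n : ℝ) ^ 3 / 3 := by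
  rw [Fin.sum_univ_eq_sum_range (fun k => (k : ℝ) ^ 2) n]
  induction n with
  | zero => simp
  | succ k ih =>
    rw [Finset.sum_range_succ]
    push_cast
    have : (0 : ℝ) ≤ k := k.cast_nonneg
    linarith

theorem card_filter_lt (k : Fin n) :
    (Finset.univ.filter fun i : Fin n => (i : ℕ) < k).card = k := by
  have : (Finset.univ.filter fun i : Fin n => (i : ℕ) < k) = Finset.Iio k := by
    ext i
    simp
  rw [this, Fin.card_Iio]

theorem partialSumSq_le (x : Fin n → E) (σ : Equiv.Perm (Fin n)) (hn : 0 < n) {v : ℝ}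
    (hv : 1 / (n : ℝ) * ∑ i, ‖x i‖ ^ 2 ≤ v) : partialSumSq x σ ≤ v / 2 := by
  have hn' : (0 : ℝ) < n := Nat.cast_pos.2 hn
  have hv0 : 0 ≤ v := le_trans (by positivity) hv
  rw [one_div, inv_mul_le_iff₀ hn'] at hv
  have h1 : ∀ k : Fin n,
      ‖∑ i ∈ Finset.univ.filter fun i : Fin n => (i : ℕ) < k, x (σ i)‖ ^ 2 ≤ k * (n * v) := by
    intro k
    refine (pow_le_pow_left₀ (norm_nonneg _) (norm_sum_le _ _) 2).trans
      (sq_sum_le_card_mul_sum_sq.trans ?_)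
    rw [card_filter_lt]
    refine mul_le_mul_of_nonneg_left (le_trans ?_ hv) (Nat.cast_nonneg _)
    rw [← Equiv.sum_comp σ fun i => ‖x i‖ ^ 2]
    exact Finset.sum_le_sum_of_subset_of_nonneg (Finset.filter_subset _ _)
      fun _ _ _ => sq_nonneg _
  rw [partialSumSq, one_div, inv_mul_le_iff₀ (by positivity)]
  refine (Finset.sum_le_sum fun k _ => h1 k).trans ?_
  rw [← Finset.sum_mul]
  refine (mul_le_mul_of_nonneg_right (sum_fin_le n) (by positivity)).trans (le_of_eq (by ring))

end Shuffle

/-! ### Drift, estimator error and decrease within one epoch -/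

namespace Data

variable {n p q m : ℕ} {P : Data n p q m} {μh Mh σJ γ : ℝ} {MF LF : Fin n → ℝ≥0}

/-- The real-valued smoothed objective `f + Φ_γ` on `dom f`. -/
def psi (P : Data n p q m) (γ : ℝ) (w : Euc p) : ℝ :=
  (P.f w).toReal + P.smoothVal γ (P.Favg w)

/-- The deviation of the `i`-th partial hyper-gradient at `w` from the hyper-gradient. -/
def gradDev (P : Data n p q m) (γ : ℝ) (w : Euc p) (i : Fin n) : Euc p :=
  P.gradTerm γ i w (P.Favg w) - P.gradPhi γ w

theorem inner_sub_start {η : ℝ} {o : FOption} {π πh : Equiv.Perm (Fin n)} {w : Euc p} {k : ℕ}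
    (hk : k ≤ n) : P.inner γ η o π πh w k - w = -((η / n) •
      ∑ i ∈ Finset.univ.filter fun i : Fin n => (i : ℕ) < k,
        P.gradEst γ o π πh (P.inner γ η o π πh w) i) := by
  induction k with
  | zero => simp [inner_zero]
  | succ k ih =>
    have hfil : (Finset.univ.filter fun i : Fin n => (i : ℕ) < k + 1)
        = insert ⟨k, hk⟩ (Finset.univ.filter fun i : Fin n => (i : ℕ) < k) := by
      ext i
      simp only [Finset.mem_filter_univ, Finset.mem_insert, Fin.ext_iff]
      omega
    have h1 := inner_succ P γ η o π πh w ⟨k, hk⟩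
    simp only at h1
    rw [hfil, Finset.sum_insert (by simp), h1, smul_add, neg_add, ← ih (Nat.le_of_succ_le hk)]
    abel

/-- The averaged estimator of an epoch. -/
theorem inner_last (P : Data n p q m) (γ η : ℝ) (o : FOption)
    (π πh : Equiv.Perm (Fin n)) (w : Euc p) :
    P.inner γ η o π πh w n = w - η • ((1 / (n : ℝ)) •
      ∑ i, P.gradEst γ o π πh (P.inner γ η o π πh w) i) := by
  have h := inner_sub_start (P := P) (γ := γ) (η := η) (o := o) (π := π) (πh := πh) (w := w)
    le_rfl
  have hfil : (Finset.univ.filter fun i : Fin n => (i : ℕ) < n) = Finset.univ := by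
    ext i; simp
  rw [hfil] at h
  rw [smul_smul, mul_one_div, sub_eq_add_neg, ← h]
  abel

namespace Regular

/-- Every deviation is the adjoint of `∇Fᵢ - ∇F` applied to the same vector `K u⋆`, so the Jacobian
variance carries over with factor `‖K u⋆‖²`. -/
theorem sum_gradDev_sq_le (R : P.Regular μh Mh σJ γ MF LF) (w : Euc p) :
    1 / (n : ℝ) * ∑ i, ‖P.gradDev γ w i‖ ^ 2 ≤ (‖P.K‖ * Mh) ^ 2 * σJ ^ 2 := by
  have hn := R.n_pos
  have hF : fderiv ℝ P.Favg w = (1 / (n : ℝ)) • ∑ i, fderiv ℝ (P.F i) w :=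
    (R.hasFDerivAt_Favg w).fderiv
  have hdev : ∀ i, P.gradDev γ w i = (fderiv ℝ (P.F i) w - fderiv ℝ P.Favg w).adjoint
      (P.K (P.uStar γ (P.Favg w))) := by
    intro i
    rw [gradDev, R.gradPhi_eq, hF]
    simp [gradTerm, map_sum]
  have h1 : ∀ i, ‖P.gradDev γ w i‖ ^ 2
      ≤ (‖P.K‖ * Mh) ^ 2 * ‖fderiv ℝ (P.F i) w - fderiv ℝ P.Favg w‖ ^ 2 := by
    intro i
    rw [hdev, ← mul_pow]
    refine pow_le_pow_left₀ (norm_nonneg _) ?_ 2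
    refine (ContinuousLinearMap.le_opNorm _ _).trans ?_
    rw [LinearIsometryEquiv.norm_map, mul_comm]
    exact mul_le_mul_of_nonneg_right (R.norm_K_uStar_le _) (norm_nonneg _)
  calc 1 / (n : ℝ) * ∑ i, ‖P.gradDev γ w i‖ ^ 2
      ≤ 1 / (n : ℝ) * ∑ i, (‖P.K‖ * Mh) ^ 2 * ‖fderiv ℝ (P.F i) w - fderiv ℝ P.Favg w‖ ^ 2 :=
        mul_le_mul_of_nonneg_left (Finset.sum_le_sum fun i _ => h1 i) (by positivity)
    _ = (‖P.K‖ * Mh) ^ 2 *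
          (1 / (n : ℝ) * ∑ i, ‖fderiv ℝ (P.F i) w - fderiv ℝ P.Favg w‖ ^ 2) := by
        rw [← Finset.mul_sum]
        ring
    _ ≤ _ := mul_le_mul_of_nonneg_left (R.base.variance w) (sq_nonneg _)

theorem sum_gradDev (R : P.Regular μh Mh σJ γ MF LF) (w : Euc p) :
    ∑ i, P.gradDev γ w i = 0 := by
  have hn := R.n_pos.ne'
  simp only [gradDev, Finset.sum_sub_distrib, Finset.sum_const, Finset.card_univ,
    Fintype.card_fin]
  rw [R.gradPhi_eq, ← Nat.cast_smul_eq_nsmul ℝ, smul_smul, mul_one_div_cancel hn, one_smul,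
    sub_self]

/-- This is where the two options are treated alike: the frozen estimator has no error, and the
updated one errs by the drift. The bound holds for every `π`, so no randomness of `π` is needed. -/
theorem Fest_sub_le (R : P.Regular μh Mh σJ γ MF LF) (o : FOption) (π : Equiv.Perm (Fin n))
    (z : ℕ → Euc p) (i : Fin n) :
    ‖P.Fest o π z i - P.Favg (z 0)‖
      ≤ ((Finset.univ.sup MF : ℝ≥0) : ℝ) * (1 / (n : ℝ) * ∑ j : Fin n, ‖z j - z 0‖) := by
  have hn := R.n_pos
  cases o with
  | frozen =>
    simp only [Fest, Favg, sub_self, norm_zero]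
    positivity
  | updated =>
    rw [Favg, ← Equiv.sum_comp π]
    simp only [Fest]
    rw [← smul_sub, ← Finset.sum_sub_distrib, norm_smul, Real.norm_of_nonneg (by positivity),
      mul_left_comm, Finset.mul_sum]
    refine mul_le_mul_of_nonneg_left ((norm_sum_le _ _).trans
      (Finset.sum_le_sum fun j _ => (R.norm_F_sub_le _ _ _).trans ?_)) (by positivity)
    refine mul_le_mul_of_nonneg_left ?_ (by positivity)
    split_ifs
    · exact le_rfl
    · simp

/-- Total deviation of the estimators in an epoch from the partial hyper-gradients at its start. -/
theorem sum_gradEst_sub_le (R : P.Regular μh Mh σJ γ MF LF) (o : FOption)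
    (π πh : Equiv.Perm (Fin n)) (z : ℕ → Euc p) :
    ∑ i, ‖P.gradEst γ o π πh z i - P.gradTerm γ (πh i) (z 0) (P.Favg (z 0))‖
      ≤ P.Q μh Mh γ MF LF * ∑ i : Fin n, ‖z i - z 0‖ := by
  have hn := R.n_pos
  have hμ := R.mu_pos
  have h1 : ∀ i, ‖P.gradEst γ o π πh z i - P.gradTerm γ (πh i) (z 0) (P.Favg (z 0))‖
      ≤ Mh * ((Finset.univ.sup LF : ℝ≥0) : ℝ) * ‖P.K‖ * ‖z i - z 0‖
        + ((Finset.univ.sup MF : ℝ≥0) : ℝ) * ‖P.K‖ ^ 2 / (μh + γ)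
          * (((Finset.univ.sup MF : ℝ≥0) : ℝ) * (1 / (n : ℝ) * ∑ j : Fin n, ‖z j - z 0‖)) :=
    fun i => (R.gradTerm_sub_le (πh i) (z i) (z 0) _ _).trans
      (add_le_add_right (mul_le_mul_of_nonneg_left (R.Fest_sub_le o π z i) (by positivity)) _)
  refine (Finset.sum_le_sum fun i _ => h1 i).trans (le_of_eq ?_)
  rw [Finset.sum_add_distrib, ← Finset.mul_sum, Finset.sum_const, Finset.card_univ,
    Fintype.card_fin, nsmul_eq_mul, Q]
  field_simp
  ring

theorem Q_nonneg (R : P.Regular μh Mh σJ γ MF LF) : 0 ≤ P.Q μh Mh γ MF LF := by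
  have := R.mu_pos
  have := R.Mh_nonneg
  rw [Q]
  positivity

/-- Reindexing the exact hyper-gradient by `πh` pairs each estimator with its own component, so
there is no sampling error over a full epoch, only drift. -/
theorem estimator_error (R : P.Regular μh Mh σJ γ MF LF) (o : FOption)
    (π πh : Equiv.Perm (Fin n)) (z : ℕ → Euc p) :
    ‖P.gradPhi γ (z 0) - (1 / (n : ℝ)) • ∑ i, P.gradEst γ o π πh z i‖ ^ 2
      ≤ P.Q μh Mh γ MF LF ^ 2 * (1 / (n : ℝ) * ∑ i : Fin n, ‖z i - z 0‖ ^ 2) := by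
  have hn := R.n_pos
  rw [R.gradPhi_eq, ← Equiv.sum_comp πh, ← smul_sub, ← Finset.sum_sub_distrib, norm_smul,
    Real.norm_of_nonneg (by positivity), mul_pow]
  have h1 := (norm_sum_le Finset.univ fun i => P.gradTerm γ (πh i) (z 0) (P.Favg (z 0))
    - P.gradEst γ o π πh z i).trans
    ((Finset.sum_le_sum fun i _ => (norm_sub_rev _ _).le).trans (R.sum_gradEst_sub_le o π πh z))
  have h2 := pow_le_pow_left₀ (norm_nonneg _) h1 2
  have h3 : (∑ i : Fin n, ‖z i - z 0‖) ^ 2 ≤ n * ∑ i : Fin n, ‖z i - z 0‖ ^ 2 := by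
    simpa using sq_sum_le_card_mul_sum_sq (s := (Finset.univ : Finset (Fin n)))
      (f := fun i => ‖z i - z 0‖)
  rw [mul_pow] at h2
  have h4 := h2.trans (mul_le_mul_of_nonneg_left h3 (sq_nonneg _))
  refine (mul_le_mul_of_nonneg_left h4 (by positivity)).trans (le_of_eq ?_)
  field_simp

/-- The sum of the first `k` estimators splits into their errors `a`, the centred deviations `b`,
and `k` copies of `∇Φ_γ`. The bound on `a` involves the drift of the whole epoch; this implicit
inequality is closed in `epoch_dev_le`. -/
theorem inner_dev_sq_le (R : P.Regular μh Mh σJ γ MF LF) {η : ℝ} (o : FOption)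
    (π πh : Equiv.Perm (Fin n)) (w : Euc p) (k : Fin n) :
    ‖P.inner γ η o π πh w k - w‖ ^ 2 ≤ 3 * (η / n) ^ 2 *
      (P.Q μh Mh γ MF LF ^ 2 * (n * ∑ i : Fin n, ‖P.inner γ η o π πh w i - w‖ ^ 2)
        + ‖∑ i ∈ Finset.univ.filter fun i : Fin n => (i : ℕ) < k, P.gradDev γ w (πh i)‖ ^ 2
        + (k : ℝ) ^ 2 * ‖P.gradPhi γ w‖ ^ 2) := by
  set z := P.inner γ η o π πh w with hz
  have hz0 : z 0 = w := inner_zero P γ η o π πh w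
  set S := Finset.univ.filter fun i : Fin n => (i : ℕ) < k with hS
  set a := ∑ i ∈ S, (P.gradEst γ o π πh z i - P.gradTerm γ (πh i) w (P.Favg w)) with ha
  set b := ∑ i ∈ S, P.gradDev γ w (πh i) with hb
  have hsum : ∑ i ∈ S, P.gradEst γ o π πh z i = a + b + (k : ℝ) • P.gradPhi γ w := by
    rw [ha, hb, ← Finset.sum_add_distrib]
    simp only [gradDev]
    have : ∀ i, P.gradEst γ o π πh z i = (P.gradEst γ o π πh z i
      - P.gradTerm γ (πh i) w (P.Favg w) + (P.gradTerm γ (πh i) w (P.Favg w)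
      - P.gradPhi γ w)) + P.gradPhi γ w := fun i => by abel
    rw [Finset.sum_congr rfl fun i _ => this i, Finset.sum_add_distrib, Finset.sum_const,
      card_filter_lt, Nat.cast_smul_eq_nsmul ℝ]
  have h1 : ‖a‖ ^ 2 ≤ P.Q μh Mh γ MF LF ^ 2 * (n * ∑ i : Fin n, ‖z i - w‖ ^ 2) := by
    have h2 := R.sum_gradEst_sub_le o π πh z
    rw [hz0] at h2
    have h3 : ‖a‖ ≤ P.Q μh Mh γ MF LF * ∑ i : Fin n, ‖z i - w‖ :=
      (norm_sum_le _ _).trans ((Finset.sum_le_sum_of_subset_of_nonneg (Finset.filter_subset _ _)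
        fun _ _ _ => norm_nonneg _).trans h2)
    have h4 : (∑ i : Fin n, ‖z i - w‖) ^ 2 ≤ n * ∑ i : Fin n, ‖z i - w‖ ^ 2 := by
      simpa using sq_sum_le_card_mul_sum_sq (s := (Finset.univ : Finset (Fin n)))
        (f := fun i => ‖z i - w‖)
    have h5 := pow_le_pow_left₀ (norm_nonneg _) h3 2
    rw [mul_pow] at h5
    exact h5.trans (mul_le_mul_of_nonneg_left h4 (sq_nonneg _))
  rw [hz, inner_sub_start k.isLt.le, ← hz, ← hS, hsum, norm_neg, norm_smul, mul_pow,
    Real.norm_eq_abs, sq_abs]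
  have h6 : ‖a + b + (k : ℝ) • P.gradPhi γ w‖ ^ 2
      ≤ 3 * (‖a‖ ^ 2 + ‖b‖ ^ 2 + (k : ℝ) ^ 2 * ‖P.gradPhi γ w‖ ^ 2) := by
    have h7 : ‖a + b + (k : ℝ) • P.gradPhi γ w‖ ≤ ‖a‖ + ‖b‖ + k * ‖P.gradPhi γ w‖ := by
      refine (norm_add₃_le).trans (le_of_eq ?_)
      rw [norm_smul, Real.norm_of_nonneg (Nat.cast_nonneg _)]
    refine (pow_le_pow_left₀ (norm_nonneg _) h7 2).trans ?_
    rw [← mul_pow]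
    nlinarith [sq_nonneg (‖a‖ - ‖b‖), sq_nonneg (‖a‖ - k * ‖P.gradPhi γ w‖),
      sq_nonneg (‖b‖ - k * ‖P.gradPhi γ w‖)]
  have h8 : 0 ≤ (η / n) ^ 2 := sq_nonneg _
  calc (η / n) ^ 2 * ‖a + b + (k : ℝ) • P.gradPhi γ w‖ ^ 2
      ≤ (η / n) ^ 2 * (3 * (‖a‖ ^ 2 + ‖b‖ ^ 2 + (k : ℝ) ^ 2 * ‖P.gradPhi γ w‖ ^ 2)) :=
        mul_le_mul_of_nonneg_left h6 h8
    _ ≤ (η / n) ^ 2 * (3 * (P.Q μh Mh γ MF LF ^ 2 * (n * ∑ i : Fin n, ‖z i - w‖ ^ 2)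
        + ‖b‖ ^ 2 + (k : ℝ) ^ 2 * ‖P.gradPhi γ w‖ ^ 2)) := by gcongr
    _ = _ := by ring

theorem epoch_dev_le (R : P.Regular μh Mh σJ γ MF LF) {η : ℝ} (o : FOption)
    (hη : η ^ 2 * P.Q μh Mh γ MF LF ^ 2 ≤ 1 / 64)
    (π πh : Equiv.Perm (Fin n)) (w : Euc p) :
    1 / (n : ℝ) * ∑ i : Fin n, ‖P.inner γ η o π πh w i - w‖ ^ 2
      ≤ 64 / 61 * η ^ 2 * (3 * partialSumSq (P.gradDev γ w) πh + ‖P.gradPhi γ w‖ ^ 2) := by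
  have hn := R.n_pos
  set D := 1 / (n : ℝ) * ∑ i : Fin n, ‖P.inner γ η o π πh w i - w‖ ^ 2 with hD
  have hD0 : 0 ≤ D := by positivity
  have hnD : ∑ i : Fin n, ‖P.inner γ η o π πh w i - w‖ ^ 2 = n * D := by
    rw [hD]; field_simp
  have h1 := Finset.sum_le_sum fun (k : Fin n) (_ : k ∈ Finset.univ) =>
    R.inner_dev_sq_le (η := η) o π πh w k
  have h2 : ∑ k : Fin n,
      ‖∑ i ∈ Finset.univ.filter fun i : Fin n => (i : ℕ) < k, P.gradDev γ w (πh i)‖ ^ 2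
      = n ^ 3 * partialSumSq (P.gradDev γ w) πh := by
    rw [partialSumSq]; field_simp
  rw [← Finset.mul_sum, Finset.sum_add_distrib, Finset.sum_add_distrib,
    ← Finset.sum_mul _ _ (‖P.gradPhi γ w‖ ^ 2), h2, hnD, Finset.sum_const, Finset.card_univ, Fintype.card_fin, nsmul_eq_mul] at h1
  have h3 := mul_le_mul_of_nonneg_right (sum_fin_sq_le n) (sq_nonneg ‖P.gradPhi γ w‖)
  have h4 : n * D ≤ 3 * (η / n) ^ 2 * (n * (P.Q μh Mh γ MF LF ^ 2 * (n * (n * D)))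
      + n ^ 3 * partialSumSq (P.gradDev γ w) πh + n ^ 3 / 3 * ‖P.gradPhi γ w‖ ^ 2) :=
    h1.trans (mul_le_mul_of_nonneg_left (add_le_add_right h3 _) (by positivity))
  have h5 : D ≤ 3 * (η ^ 2 * P.Q μh Mh γ MF LF ^ 2) * D
      + η ^ 2 * (3 * partialSumSq (P.gradDev γ w) πh + ‖P.gradPhi γ w‖ ^ 2) := by
    refine le_of_mul_le_mul_left (h4.trans (le_of_eq ?_)) hn
    field_simp
    ring
  -- The drift on the right has coefficient at most `3/64`; moving it to the left leaves `61/64`.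
  have h6 := mul_le_mul_of_nonneg_right hη hD0
  linarith

theorem partialSumSq_gradDev_le (R : P.Regular μh Mh σJ γ MF LF) (w : Euc p)
    (σ : Equiv.Perm (Fin n)) :
    partialSumSq (P.gradDev γ w) σ ≤ (‖P.K‖ * Mh) ^ 2 * σJ ^ 2 / 2 :=
  partialSumSq_le _ σ R.pos (R.sum_gradDev_sq_le w)

/-- Decrease of the smoothed objective over one epoch. -/
theorem epoch_descent (R : P.Regular μh Mh σJ γ MF LF) {η Λ0 Λ1 : ℝ} (o : FOption)
    (hη : 0 < η) (hΛ0 : 1 ≤ Λ0) (hΛ1 : 0 ≤ Λ1)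
    (hηQ : η ^ 2 * P.Q μh Mh γ MF LF ^ 2 * Λ0 ≤ 1 / 64)
    (hG : P.GradMapBound γ η Λ0 Λ1) (π πh : Equiv.Perm (Fin n)) {w : Euc p}
    (hw : w ∈ effDom P.f) :
    η / 4 * ‖P.gradMap γ η w‖ ^ 2 + P.psi γ (prox η P.f (P.inner γ η o π πh w n))
      ≤ P.psi γ w + η * (η ^ 2 * P.Q μh Mh γ MF LF ^ 2)
        * (3 * partialSumSq (P.gradDev γ w) πh + Λ1) := by
  set Q := P.Q μh Mh γ MF LF with hQ
  have hQ0 : 0 ≤ Q := R.Q_nonneg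
  have hηQ0 : 0 ≤ η ^ 2 * Q ^ 2 := by positivity
  have hηQ1 : η ^ 2 * Q ^ 2 ≤ 1 / 64 := by nlinarith
  have hηQ2 : η * Q ≤ 1 := by
    have : (η * Q) ^ 2 ≤ 1 := by rw [mul_pow]; linarith
    exact (sq_le_one_iff₀ (by positivity)).1 this
  have hV : 0 ≤ partialSumSq (P.gradDev γ w) πh := by unfold partialSumSq; positivity
  set s := (1 / (n : ℝ)) • ∑ i, P.gradEst γ o π πh (P.inner γ η o π πh w) i with hs
  have h1 := prox_grad_step (φ := fun x => P.smoothVal γ (P.Favg x)) (φ' := P.gradPhi γ)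
    (fun x => by rw [R.gradPhi_eq]; exact R.hasGradientAt_Phi x) R.gradPhi_lipschitz
    R.base.f_convex hη hηQ2 hw s
  have h2 := R.estimator_error o π πh (P.inner γ η o π πh w)
  rw [inner_zero] at h2
  have h3 := R.epoch_dev_le o hηQ1 π πh w
  have h4 := h2.trans (mul_le_mul_of_nonneg_left h3 (sq_nonneg Q))
  have h5 : 1 / (2 * η) * ‖w - prox η P.f (w - η • P.gradPhi γ w)‖ ^ 2
      = η / 2 * ‖P.gradMap γ η w‖ ^ 2 := by
    rw [gradMap, norm_smul, Real.norm_of_nonneg (inv_nonneg.2 hη.le)]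
    field_simp
  rw [h5] at h1
  rw [inner_last, psi, psi]
  have h6 := hG w hw
  have hc : 0 ≤ 64 / 61 * (η ^ 2 * Q ^ 2) := by positivity
  have h7 : ‖P.gradPhi γ w - s‖ ^ 2 ≤ 64 / 61 * (η ^ 2 * Q ^ 2)
      * (3 * partialSumSq (P.gradDev γ w) πh + (Λ0 * ‖P.gradMap γ η w‖ ^ 2 + Λ1)) := by
    refine h4.trans (le_trans (le_of_eq (by ring)) (mul_le_mul_of_nonneg_left
      (add_le_add_right h6 (3 * partialSumSq (P.gradDev γ w) πh)) hc))
  -- The coefficient is at most `1/61`, so half of the decrease `η/2 ‖𝒢_η‖²` pays for this term.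
  have h8 : 64 / 61 * (η ^ 2 * Q ^ 2) * (Λ0 * ‖P.gradMap γ η w‖ ^ 2)
      ≤ 1 / 2 * ‖P.gradMap γ η w‖ ^ 2 := by
    have := mul_le_mul_of_nonneg_right hηQ (sq_nonneg ‖P.gradMap γ η w‖)
    nlinarith [sq_nonneg ‖P.gradMap γ η w‖]
  have h9 : η / 2 * ‖P.gradPhi γ w - s‖ ^ 2 ≤ η / 4 * ‖P.gradMap γ η w‖ ^ 2
      + η / 2 * (64 / 61 * (η ^ 2 * Q ^ 2)
      * (3 * partialSumSq (P.gradDev γ w) πh + Λ1)) := by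
    have : ‖P.gradPhi γ w - s‖ ^ 2 ≤ 1 / 2 * ‖P.gradMap γ η w‖ ^ 2 + 64 / 61 * (η ^ 2 * Q ^ 2)
      * (3 * partialSumSq (P.gradDev γ w) πh + Λ1) := by linarith
    refine (mul_le_mul_of_nonneg_left this (by positivity)).trans (le_of_eq (by ring))
  -- Nonnegativity allows the factor `η/2 * 64/61` to be relaxed to `η`.
  have h10 : 0 ≤ η * (η ^ 2 * Q ^ 2) * (3 * partialSumSq (P.gradDev γ w) πh + Λ1) := by
    positivity
  linarith

end Regular

end Data

/-! ### Second moments under sampling without replacement -/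

section Sampling

variable {n : ℕ} {E : Type*} [NormedAddCommGroup E]

theorem sum_perm_mul_right {β : Type*} [AddCommMonoid β] (F : Equiv.Perm (Fin n) → β)
    (τ : Equiv.Perm (Fin n)) : ∑ σ, F (σ * τ) = ∑ σ, F σ :=
  Equiv.sum_comp (Equiv.mulRight τ) F

theorem sum_perm_norm_sq (x : Fin n → E) (i : Fin n) :
    n * ∑ σ : Equiv.Perm (Fin n), ‖x (σ i)‖ ^ 2
      = Fintype.card (Equiv.Perm (Fin n)) * ∑ l, ‖x l‖ ^ 2 := by
  have hconst : ∀ l, ∑ σ : Equiv.Perm (Fin n), ‖x (σ l)‖ ^ 2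
      = ∑ σ : Equiv.Perm (Fin n), ‖x (σ i)‖ ^ 2 := by
    intro l
    rw [← sum_perm_mul_right (fun σ => ‖x (σ i)‖ ^ 2) (Equiv.swap i l)]
    simp
  have h : ∑ l, ∑ σ : Equiv.Perm (Fin n), ‖x (σ l)‖ ^ 2
      = n * ∑ σ : Equiv.Perm (Fin n), ‖x (σ i)‖ ^ 2 := by
    rw [Finset.sum_congr rfl fun l _ => hconst l]
    simp
  rw [← h, Finset.sum_comm, Finset.sum_congr rfl fun σ _ => Equiv.sum_comp σ fun l => ‖x l‖ ^ 2]
  simp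

variable [InnerProductSpace ℝ E]

/-- Distinct draws without replacement from a centred population are negatively correlated. -/
theorem sum_perm_inner_nonpos {x : Fin n → E} (hx : ∑ i, x i = 0) {i j : Fin n} (hij : i ≠ j) :
    ∑ σ : Equiv.Perm (Fin n), ⟪x (σ i), x (σ j)⟫_ℝ ≤ 0 := by
  -- Right multiplication by a transposition shows that all off-diagonal sums agree. With the
  -- nonnegative diagonal term they add up to zero, so their common value is nonpositive.
  have hconst : ∀ l ∈ Finset.univ.erase i, ∑ σ : Equiv.Perm (Fin n), ⟪x (σ i), x (σ l)⟫_ℝ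
      = ∑ σ : Equiv.Perm (Fin n), ⟪x (σ i), x (σ j)⟫_ℝ := by
    intro l hl
    rw [← sum_perm_mul_right (fun σ => ⟪x (σ i), x (σ j)⟫_ℝ) (Equiv.swap j l)]
    refine Finset.sum_congr rfl fun σ _ => ?_
    rw [Equiv.Perm.mul_apply, Equiv.Perm.mul_apply, Equiv.swap_apply_left,
      Equiv.swap_apply_of_ne_of_ne hij (Finset.ne_of_mem_erase hl).symm]
  have hzero : ∑ l, ∑ σ : Equiv.Perm (Fin n), ⟪x (σ i), x (σ l)⟫_ℝ = 0 := by
    rw [Finset.sum_comm]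
    refine Finset.sum_eq_zero fun σ _ => ?_
    rw [← inner_sum, Equiv.sum_comp σ x, hx, inner_zero_right]
  rw [← Finset.add_sum_erase _ _ (Finset.mem_univ i), Finset.sum_congr rfl hconst,
    Finset.sum_const, nsmul_eq_mul] at hzero
  have hpos : (0 : ℝ) < (Finset.univ.erase i).card :=
    Nat.cast_pos.2 (Finset.card_pos.2 ⟨j, by simp [hij.symm]⟩)
  have hself : 0 ≤ ∑ σ : Equiv.Perm (Fin n), ⟪x (σ i), x (σ i)⟫_ℝ :=
    Finset.sum_nonneg fun _ _ => real_inner_self_nonneg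
  by_contra h
  have := mul_pos hpos (not_le.1 h)
  linarith

/-- In the expanded square the cross terms are nonpositive on average, so only the `S.card` diagonal
terms remain; Cauchy–Schwarz would cost another factor `S.card`. -/
theorem sum_perm_partialSum_sq_le {x : Fin n → E} (hx : ∑ i, x i = 0) (S : Finset (Fin n)) :
    n * ∑ σ : Equiv.Perm (Fin n), ‖∑ i ∈ S, x (σ i)‖ ^ 2
      ≤ S.card * (Fintype.card (Equiv.Perm (Fin n)) * ∑ l, ‖x l‖ ^ 2) := by
  have h1 : ∑ σ : Equiv.Perm (Fin n), ‖∑ i ∈ S, x (σ i)‖ ^ 2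
      ≤ ∑ i ∈ S, ∑ σ : Equiv.Perm (Fin n), ‖x (σ i)‖ ^ 2 := by
    simp only [← real_inner_self_eq_norm_sq, sum_inner, inner_sum]
    rw [Finset.sum_comm]
    refine Finset.sum_le_sum fun i hi => ?_
    rw [Finset.sum_comm, ← Finset.add_sum_erase _ _ hi]
    have := Finset.sum_nonpos fun (j : Fin n) (hj : j ∈ S.erase i) =>
      sum_perm_inner_nonpos hx (Finset.ne_of_mem_erase hj)
    have h2 := Finset.sum_congr rfl fun (j : Fin n) (_ : j ∈ S.erase i) =>
      Finset.sum_congr rfl fun (σ : Equiv.Perm (Fin n)) (_ : σ ∈ Finset.univ) =>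
        real_inner_comm (x (σ i)) (x (σ j))
    linarith
  refine (mul_le_mul_of_nonneg_left h1 (Nat.cast_nonneg _)).trans (le_of_eq ?_)
  rw [Finset.mul_sum, Finset.sum_congr rfl fun i _ => sum_perm_norm_sq x i, Finset.sum_const,
    nsmul_eq_mul]

/-- The mean of `partialSumSq` over all permutations, for a centred population. -/
theorem sum_perm_partialSumSq_le {x : Fin n → E} (hn : 0 < n) (hx : ∑ i, x i = 0) {v : ℝ}
    (hv : 1 / (n : ℝ) * ∑ i, ‖x i‖ ^ 2 ≤ v) :
    ∑ σ, partialSumSq x σ ≤ Fintype.card (Equiv.Perm (Fin n)) * (v / (2 * n)) := by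
  have hn' : (0 : ℝ) < n := Nat.cast_pos.2 hn
  have hv0 : 0 ≤ v := le_trans (by positivity) hv
  rw [one_div, inv_mul_le_iff₀ hn'] at hv
  set N : ℝ := (Fintype.card (Equiv.Perm (Fin n)) : ℝ) with hN
  have hN0 : 0 ≤ N := Nat.cast_nonneg _
  simp only [partialSumSq]
  rw [← Finset.mul_sum, Finset.sum_comm, one_div, inv_mul_le_iff₀ (by positivity)]
  have h1 : ∀ k : Fin n, ∑ σ : Equiv.Perm (Fin n),
      ‖∑ i ∈ Finset.univ.filter fun i : Fin n => (i : ℕ) < k, x (σ i)‖ ^ 2 ≤ k * (N * v) := by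
    intro k
    have h2 := sum_perm_partialSum_sq_le hx (Finset.univ.filter fun i : Fin n => (i : ℕ) < k)
    rw [card_filter_lt] at h2
    refine le_of_mul_le_mul_left (h2.trans ?_) hn'
    refine (mul_le_mul_of_nonneg_left (mul_le_mul_of_nonneg_left hv hN0)
      (Nat.cast_nonneg _)).trans (le_of_eq (by ring))
  refine (Finset.sum_le_sum fun k _ => h1 k).trans ?_
  rw [← Finset.sum_mul]
  refine (mul_le_mul_of_nonneg_right (sum_fin_le n) (by positivity)).trans (le_of_eq ?_)
  field_simp

end Sampling

/-! ### Averaging over an independent uniform permutation -/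

section Probability

instance (n : ℕ) : MeasurableSingletonClass (Equiv.Perm (Fin n)) :=
  ⟨fun _ => MeasurableSpace.measurableSet_top⟩

variable {n : ℕ} {Ω A : Type*} [MeasurableSpace Ω] {ρ : Measure Ω} [IsProbabilityMeasure ρ]
  [MeasurableSpace A] [Finite A] [MeasurableSingletonClass A]

/-- Finitely many permutations determine each iterate, so integrability requires no measurability of
`prox` or `uStar`. -/
theorem integrable_comp_of_finite {X : Ω → A} (hX : Measurable X) (g : A → ℝ) :
    Integrable (fun ω => g (X ω)) ρ :=
  have : IsProbabilityMeasure (ρ.map X) := Measure.isProbabilityMeasure_map hX.aemeasurable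
  (Integrable.of_finite (μ := ρ.map X) (f := g)).comp_measurable hX

theorem integral_uniformOn_perm (g : Equiv.Perm (Fin n) → ℝ) :
    ∫ σ, g σ ∂(uniformOn Set.univ)
      = (Fintype.card (Equiv.Perm (Fin n)) : ℝ)⁻¹ * ∑ σ, g σ := by
  have : IsProbabilityMeasure (uniformOn (Set.univ : Set (Equiv.Perm (Fin n)))) :=
    isProbabilityMeasure_uniformOn Set.finite_univ Set.univ_nonempty
  rw [integral_fintype Integrable.of_finite, Finset.mul_sum]
  refine Finset.sum_congr rfl fun σ _ => ?_
  rw [measureReal_def, uniformOn_univ, Measure.count_singleton, smul_eq_mul]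
  simp

/-- By independence the joint law is a product, and Fubini averages over `σ` with `X` frozen. -/
theorem integral_indep_uniform_le {X : Ω → A} {σ : Ω → Equiv.Perm (Fin n)} (hX : Measurable X)
    (hσ : Measurable σ) (hind : IndepFun X σ ρ) (hunif : ρ.map σ = uniformOn Set.univ)
    {V : A → Equiv.Perm (Fin n) → ℝ} {c : ℝ}
    (hV : ∀ a, ∑ s, V a s ≤ Fintype.card (Equiv.Perm (Fin n)) * c) :
    ∫ ω, V (X ω) (σ ω) ∂ρ ≤ c := by
  have h1 : IsProbabilityMeasure (ρ.map X) := Measure.isProbabilityMeasure_map hX.aemeasurable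
  have h2 : IsProbabilityMeasure (uniformOn (Set.univ : Set (Equiv.Perm (Fin n)))) :=
    isProbabilityMeasure_uniformOn Set.finite_univ Set.univ_nonempty
  have hmap := (indepFun_iff_map_prod_eq_prod_map_map hX.aemeasurable hσ.aemeasurable).1 hind
  rw [hunif] at hmap
  have h3 : ∫ ω, V (X ω) (σ ω) ∂ρ
      = ∫ z, V z.1 z.2 ∂((ρ.map X).prod (uniformOn Set.univ)) := by
    rw [← hmap, integral_map (hX.prodMk hσ).aemeasurable]
    exact (Measurable.of_discrete).aestronglyMeasurable
  rw [h3, integral_prod _ Integrable.of_finite]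
  have h4 : ∀ a, ∫ s, V a s ∂(uniformOn Set.univ) ≤ c := by
    intro a
    rw [integral_uniformOn_perm, inv_mul_le_iff₀ (Nat.cast_pos.2 Fintype.card_pos)]
    exact hV a
  refine (integral_mono Integrable.of_finite (integrable_const c) h4).trans (le_of_eq ?_)
  simp

end Probability

/-! ### Smoothing gap and summation over epochs -/

namespace Data

variable {n p q m : ℕ} {P : Data n p q m} {μh Mh σJ γ : ℝ} {MF LF : Fin n → ℝ≥0}

namespace Regular

theorem toReal_hSmooth (R : P.Regular μh Mh σJ γ MF LF) {u : Euc q} (hu : u ∈ effDom P.h) :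
    (P.hSmooth γ u).toReal = (P.h u).toReal + γ * (P.b u).toReal := by
  have hb := R.proxFun.dom_subset hu
  have e := R.proxFun.convex.coe_toReal hb
  rw [hSmooth, ← e, ← EReal.coe_mul, EReal.toReal_add hu (R.base.h_convex.ne_bot u)
    (EReal.coe_ne_top _) (EReal.coe_ne_bot _), EReal.toReal_coe, EReal.toReal_coe]

theorem b_bddBelow (R : P.Regular μh Mh σJ γ MF LF) :
    BddBelow ((fun u => (P.b u).toReal) '' effDom P.h) := by
  obtain ⟨c, hc⟩ := R.proxFun.convex.bddBelow_on_compact (isCompact_closedBall (0 : Euc q) Mh)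
  refine ⟨c, ?_⟩
  rintro _ ⟨u, hu, rfl⟩
  exact hc u (by simpa using R.base.h_dom_bounded u hu) (R.proxFun.dom_subset hu)

theorem Phi0_le (R : P.Regular μh Mh σJ γ MF LF) (w : Euc p) :
    P.Phi0 w ≤ ((P.smoothVal γ (P.Favg w)
      + γ * sSup ((fun u => (P.b u).toReal) '' effDom P.h) : ℝ) : EReal) := by
  refine iSup_le fun u => ?_
  by_cases hu : u ∈ effDom P.h
  · rw [← R.base.h_convex.coe_toReal hu, ← EReal.coe_sub, EReal.coe_le_coe_iff]
    have h1 := uStar_growth R.hSmooth_convex.1 R.mu_pos (P.Favg w) (u := u)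
      (by rw [R.hSmooth_convex.2]; exact hu)
    rw [R.toReal_hSmooth hu] at h1
    have h2 : (P.b u).toReal ≤ sSup ((fun u => (P.b u).toReal) '' effDom P.h) :=
      le_csSup R.proxFun.bddAbove ⟨u, hu, rfl⟩
    have h3 := mul_le_mul_of_nonneg_left h2 R.gamma_nonneg
    have hμ := R.mu_pos
    have h4 : 0 ≤ (μh + γ) / 2 * ‖P.uStar γ (P.Favg w) - u‖ ^ 2 := by positivity
    linarith
  · rw [not_not.1 hu, EReal.sub_top]
    exact bot_le

theorem le_Phi0 (R : P.Regular μh Mh σJ γ MF LF) (w : Euc p) :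
    ((P.smoothVal γ (P.Favg w)
      + γ * sInf ((fun u => (P.b u).toReal) '' effDom P.h) : ℝ) : EReal) ≤ P.Phi0 w := by
  have hu := R.uStar_mem (P.Favg w)
  refine le_trans ?_ (le_iSup _ (P.uStar γ (P.Favg w)))
  rw [← R.base.h_convex.coe_toReal hu, ← EReal.coe_sub, EReal.coe_le_coe_iff, smoothVal,
    R.toReal_hSmooth hu]
  have h2 : sInf ((fun u => (P.b u).toReal) '' effDom P.h)
      ≤ (P.b (P.uStar γ (P.Favg w))).toReal := csInf_le R.b_bddBelow ⟨_, hu, rfl⟩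
  have h3 := mul_le_mul_of_nonneg_left h2 R.gamma_nonneg
  linarith

/-- The smoothing error in the optimality gap is at most `γ` times the oscillation of `b`. -/
theorem psi_gap_le (R : P.Regular μh Mh σJ γ MF LF) {w₀ w : Euc p} (hw₀ : w₀ ∈ effDom P.f)
    (hw : w ∈ effDom P.f) :
    P.psi γ w₀ - P.psi γ w ≤ (P.Psi0 w₀).toReal - P.Psi0Star.toReal + γ * P.oscB := by
  have h1 : P.psi γ w₀ + γ * sInf ((fun u => (P.b u).toReal) '' effDom P.h)
      ≤ (P.Psi0 w₀).toReal := by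
    have h2 := add_le_add_right (R.le_Phi0 w₀) (P.f w₀)
    rw [← R.base.f_convex.coe_toReal hw₀, ← EReal.coe_add, R.base.f_convex.coe_toReal hw₀] at h2
    have h3 : P.Psi0 w₀ ≠ ⊤ :=
      EReal.add_ne_top hw₀ ((R.Phi0_le w₀).trans_lt (EReal.coe_lt_top _)).ne
    have h4 := EReal.toReal_le_toReal h2 (EReal.coe_ne_bot _) h3
    rw [EReal.toReal_coe] at h4
    rw [psi]
    exact le_trans (le_of_eq (by ring)) h4
  have h2 : P.Psi0Star.toReal
      ≤ P.psi γ w + γ * sSup ((fun u => (P.b u).toReal) '' effDom P.h) := by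
    have h3 := (iInf_le P.Psi0 w).trans (add_le_add_right (R.Phi0_le w) (P.f w))
    rw [← R.base.f_convex.coe_toReal hw, ← EReal.coe_add] at h3
    -- Finiteness of `Ψ₀⋆` from below matters here, because `toReal` sends `⊥` to `0`.
    have h4 := EReal.toReal_le_toReal h3 R.base.psi0_bddBelow (EReal.coe_ne_top _)
    rw [EReal.toReal_coe] at h4
    rw [psi]
    exact h4.trans (le_of_eq (by ring))
  rw [oscB]
  linarith

theorem iter_mem (R : P.Regular μh Mh σJ γ MF LF) {η : ℝ} (hη : 0 < η) (o : FOption)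
    (π πh : ℕ → Equiv.Perm (Fin n)) {w₀ : Euc p} (hw₀ : w₀ ∈ effDom P.f) (t : ℕ) :
    P.iter γ η o π πh w₀ t ∈ effDom P.f := by
  cases t with
  | zero => exact hw₀
  | succ t => exact prox_mem R.base.f_convex hη _

/-- The per-epoch descent inequalities, summed up along the outer iterates. -/
theorem sum_gradMap_le (R : P.Regular μh Mh σJ γ MF LF) {η Λ0 Λ1 : ℝ} (o : FOption)
    (hη : 0 < η) (hΛ0 : 1 ≤ Λ0) (hΛ1 : 0 ≤ Λ1)
    (hηQ : η ^ 2 * P.Q μh Mh γ MF LF ^ 2 * Λ0 ≤ 1 / 64)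
    (hG : P.GradMapBound γ η Λ0 Λ1) (π πh : ℕ → Equiv.Perm (Fin n)) {w₀ : Euc p}
    (hw₀ : w₀ ∈ effDom P.f) (N : ℕ) :
    η / 4 * ∑ t ∈ Finset.range N, ‖P.gradMap γ η (P.iter γ η o π πh w₀ t)‖ ^ 2
      ≤ (P.Psi0 w₀).toReal - P.Psi0Star.toReal + γ * P.oscB
        + η * (η ^ 2 * P.Q μh Mh γ MF LF ^ 2) * ∑ t ∈ Finset.range N,
          (3 * partialSumSq (P.gradDev γ (P.iter γ η o π πh w₀ t)) (πh t) + Λ1) := by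
  have h1 : ∀ N, η / 4 * ∑ t ∈ Finset.range N, ‖P.gradMap γ η (P.iter γ η o π πh w₀ t)‖ ^ 2
      + P.psi γ (P.iter γ η o π πh w₀ N)
      ≤ P.psi γ w₀ + η * (η ^ 2 * P.Q μh Mh γ MF LF ^ 2) * ∑ t ∈ Finset.range N,
          (3 * partialSumSq (P.gradDev γ (P.iter γ η o π πh w₀ t)) (πh t) + Λ1) := by
    intro N
    induction N with
    | zero => simp [iter]
    | succ N ih =>
      have h2 := R.epoch_descent o hη hΛ0 hΛ1 hηQ hG (π N) (πh N)
        (R.iter_mem hη o π πh hw₀ N)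
      rw [Finset.sum_range_succ, Finset.sum_range_succ, mul_add, mul_add, iter]
      linarith
  have h2 := R.psi_gap_le hw₀ (R.iter_mem hη o π πh hw₀ N)
  linarith [h1 N]

end Regular

theorem iter_congr (η : ℝ) (o : FOption) {π πh π' πh' : ℕ → Equiv.Perm (Fin n)} (w₀ : Euc p)
    {t : ℕ} (h : ∀ s < t, π s = π' s) (hh : ∀ s < t, πh s = πh' s) :
    P.iter γ η o π πh w₀ t = P.iter γ η o π' πh' w₀ t := by
  induction t with
  | zero => rfl
  | succ t ih =>
    rw [iter, iter, ih (fun s hs => h s (hs.trans t.lt_succ_self))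
      (fun s hs => hh s (hs.trans t.lt_succ_self)), h t t.lt_succ_self, hh t t.lt_succ_self]

/-- The indices of the permutations that are used in the first `t` epochs. -/
abbrev pastIndex (t : ℕ) : Finset (ℕ ⊕ ℕ) := (Finset.range t).disjSum (Finset.range t)

/-- The outer iterate `t` as a function of the permutations of the first `t` epochs. -/
def iterOfPast (P : Data n p q m) (γ η : ℝ) (o : FOption) (w₀ : Euc p) (t : ℕ)
    (a : pastIndex t → Equiv.Perm (Fin n)) : Euc p :=
  -- The filler value `1` is never read in the first `t` epochs.
  P.iter γ η o (fun s => if h : Sum.inl s ∈ pastIndex t then a ⟨_, h⟩ else 1)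
    (fun s => if h : Sum.inr s ∈ pastIndex t then a ⟨_, h⟩ else 1) w₀ t

theorem iterOfPast_eq (η : ℝ) (o : FOption) (π πh : ℕ → Equiv.Perm (Fin n)) (w₀ : Euc p)
    (t : ℕ) : P.iterOfPast γ η o w₀ t (fun i => Sum.elim π πh i) = P.iter γ η o π πh w₀ t :=
  iter_congr η o w₀ (fun s hs => by simp [hs]) (fun s hs => by simp [hs])

/-! ### Expectations along the random iterates -/

section Random

variable {Ω : Type*} {π πh : ℕ → Ω → Equiv.Perm (Fin n)}

theorem comp_iter_eq (η : ℝ) (o : FOption) (w₀ : Euc p) (t : ℕ) (ω : Ω) :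
    P.iter γ η o (fun s => π s ω) (fun s => πh s ω) w₀ t
      = P.iterOfPast γ η o w₀ t (fun i => Sum.elim π πh i ω) := by
  rw [← iterOfPast_eq]
  congr 1
  funext i
  rcases i with ⟨i | i, hi⟩ <;> rfl

variable [MeasurableSpace Ω] {ρ : Measure Ω}

theorem measurable_past (h : IsRandomShuffling ρ π πh) (t : ℕ) :
    Measurable fun ω (i : pastIndex t) => Sum.elim π πh i ω := by
  refine measurable_pi_iff.2 fun i => ?_
  rcases i with ⟨i | i, hi⟩
  · exact h.measurable_left i
  · exact h.measurable_right i

/-- The past stops at index `t - 1`, so `Sum.inr t` is not among its indices. -/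
theorem indepFun_past (h : IsRandomShuffling ρ π πh) (t : ℕ) :
    IndepFun (fun ω (i : pastIndex t) => Sum.elim π πh i ω) (πh t) ρ := by
  have hm : ∀ i, Measurable (Sum.elim π πh i) := by
    rintro (i | i)
    · exact h.measurable_left i
    · exact h.measurable_right i
  have h1 := h.indep.indepFun_finset (pastIndex t) {Sum.inr t} (by simp) hm
  exact h1.comp measurable_id (measurable_pi_apply ⟨Sum.inr t, Finset.mem_singleton_self _⟩)

variable [IsProbabilityMeasure ρ]

theorem integrable_comp_iter (h : IsRandomShuffling ρ π πh) (η : ℝ) (o : FOption) (w₀ : Euc p)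
    (t : ℕ) (g : Euc p → ℝ) :
    Integrable (fun ω => g (P.iter γ η o (fun s => π s ω) (fun s => πh s ω) w₀ t)) ρ := by
  simp only [comp_iter_eq]
  exact integrable_comp_of_finite (measurable_past h t) fun a => g (P.iterOfPast γ η o w₀ t a)

theorem integrable_partialSumSq (h : IsRandomShuffling ρ π πh) (η : ℝ) (o : FOption)
    (w₀ : Euc p) (t : ℕ) :
    Integrable (fun ω => partialSumSq (P.gradDev γ
      (P.iter γ η o (fun s => π s ω) (fun s => πh s ω) w₀ t)) (πh t ω)) ρ := by
  simp only [comp_iter_eq]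
  exact integrable_comp_of_finite ((measurable_past h t).prodMk (h.measurable_right t))
    fun a => partialSumSq (P.gradDev γ (P.iterOfPast γ η o w₀ t a.1)) a.2

theorem Regular.integral_partialSumSq_le (R : P.Regular μh Mh σJ γ MF LF)
    (h : IsRandomShuffling ρ π πh) (η : ℝ) (o : FOption) (w₀ : Euc p) (t : ℕ) :
    ∫ ω, partialSumSq (P.gradDev γ
      (P.iter γ η o (fun s => π s ω) (fun s => πh s ω) w₀ t)) (πh t ω) ∂ρ
      ≤ (‖P.K‖ * Mh) ^ 2 * σJ ^ 2 / (2 * n) := by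
  simp only [comp_iter_eq]
  exact integral_indep_uniform_le
    (V := fun a => partialSumSq (P.gradDev γ (P.iterOfPast γ η o w₀ t a)))
    (measurable_past h t) (h.measurable_right t) (indepFun_past h t) (h.uniform_right t)
    fun a => sum_perm_partialSumSq_le R.pos (R.sum_gradDev _) (R.sum_gradDev_sq_le _)

end Random

end Data

/-- Passage from the summed descent inequality to the averaged stationarity measure. -/
theorem average_le_of_sum_le {η Q D ε Δ V S : ℝ} {T : ℕ} (hη : 0 < η) (hε : 0 < ε)
    (hV : 4 * (η ^ 2 * Q ^ 2) * V ≤ ε ^ 2 / 2) (hT : D * Δ < (T : ℝ) + 1)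
    (hD : D * (η * ε ^ 2) = 8)
    (hS : η / 4 * S ≤ Δ + η * (η ^ 2 * Q ^ 2) * (((T : ℝ) + 1) * V)) :
    1 / ((T : ℝ) + 1) * S ≤ ε ^ 2 := by
  have hT0 : (0 : ℝ) < (T : ℝ) + 1 := by positivity
  rw [one_div, inv_mul_le_iff₀ hT0]
  -- Since `D = 8 / (η ε²)`, the gap term `4 Δ / (η (T + 1))` is at most `ε²/2`; `hV` bounds the
  -- noise by the other half.
  have h1 : 8 * Δ ≤ ((T : ℝ) + 1) * (η * ε ^ 2) := by
    have := mul_le_mul_of_nonneg_right hT.le (show 0 ≤ η * ε ^ 2 by positivity)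
    calc 8 * Δ = D * Δ * (η * ε ^ 2) := by rw [← hD]; ring
      _ ≤ _ := this
  have h2 := mul_le_mul_of_nonneg_left hV (mul_nonneg hη.le hT0.le)
  refine le_of_mul_le_mul_left ?_ hη
  linarith

theorem step_size_sq_le {η Q Λ0 : ℝ} (hη : 0 < η) (hQ : 0 < Q) (hΛ0 : 1 ≤ Λ0)
    (h : η ≤ 1 / (8 * Q * √Λ0)) : η ^ 2 * Q ^ 2 * Λ0 ≤ 1 / 64 := by
  have hs : 0 < √Λ0 := Real.sqrt_pos.2 (by linarith)
  rw [le_div_iff₀ (by positivity)] at h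
  have h1 := pow_le_pow_left₀ (by positivity) h 2
  have h2 : (η * (8 * Q * √Λ0)) ^ 2 = 64 * (η ^ 2 * Q ^ 2 * Λ0) := by
    rw [mul_pow, mul_pow, Real.sq_sqrt (by linarith)]
    ring
  linarith

end NLShuffle

end

/-! ### Choice of step size and number of epochs -/

theorem mainTheorem1 {n p q m : ℕ} (hn : 0 < n) (P : NLShuffle.Data n p q m)
    (μh Mh σJ γ Λ0 Λ1 ε : ℝ) (MF LF : Fin n → ℝ≥0)
    (hP : P.Assumptions μh Mh σJ MF LF) (hb : P.IsProxFunction)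
    (hγ : 0 ≤ γ) (hμγ : 0 < μh + γ) (hΛ0 : 1 ≤ Λ0) (hΛ1 : 0 ≤ Λ1) (hε : 0 < ε)
    (hQ : 0 < P.Q μh Mh γ MF LF) (hD : 0 < 4 * Mh ^ 2 * ‖P.K‖ ^ 2 * σJ ^ 2 + Λ1)
    (o : NLShuffle.FOption) (w₀ : NLShuffle.Euc p) (hw₀ : w₀ ∈ NLShuffle.effDom P.f) :
    -- arbitrary permutations
    (∀ (η : ℝ) (T : ℕ) (π πh : ℕ → Equiv.Perm (Fin n)),
      η = ε / (8 * P.Q μh Mh γ MF LF * √(4 * Mh ^ 2 * ‖P.K‖ ^ 2 * σJ ^ 2 + Λ1)) →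
      η ≤ 1 / (8 * P.Q μh Mh γ MF LF * √Λ0) →
      P.GradMapBound γ η Λ0 Λ1 →
      ⌊64 * P.Q μh Mh γ MF LF * √(4 * Mh ^ 2 * ‖P.K‖ ^ 2 * σJ ^ 2 + Λ1)
          * ((P.Psi0 w₀).toReal - P.Psi0Star.toReal + γ * P.oscB) / ε ^ 3⌋₊ ≤ T →
      1 / ((T : ℝ) + 1) * ∑ t ∈ Finset.range (T + 1),
        ‖P.gradMap γ η (P.iter γ η o π πh w₀ t)‖ ^ 2 ≤ ε ^ 2) ∧
    -- independent uniformly random permutations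
    (∀ (η : ℝ) (T : ℕ) (Ω : Type*) [MeasurableSpace Ω] (ρ : Measure Ω) [IsProbabilityMeasure ρ]
        (π πh : ℕ → Ω → Equiv.Perm (Fin n)), NLShuffle.IsRandomShuffling ρ π πh →
      η = √n * ε / (8 * P.Q μh Mh γ MF LF * √(4 * Mh ^ 2 * ‖P.K‖ ^ 2 * σJ ^ 2 + n * Λ1)) →
      η ≤ 1 / (8 * P.Q μh Mh γ MF LF * √Λ0) →
      P.GradMapBound γ η Λ0 Λ1 →
      ⌊64 * P.Q μh Mh γ MF LF * √(4 * Mh ^ 2 * ‖P.K‖ ^ 2 * σJ ^ 2 + n * Λ1)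
          * ((P.Psi0 w₀).toReal - P.Psi0Star.toReal + γ * P.oscB) / (√n * ε ^ 3)⌋₊ ≤ T →
      (∀ t, Integrable (fun ω => ‖P.gradMap γ η
        (P.iter γ η o (fun s => π s ω) (fun s => πh s ω) w₀ t)‖ ^ 2) ρ) ∧
      1 / ((T : ℝ) + 1) * ∑ t ∈ Finset.range (T + 1),
        ∫ ω, ‖P.gradMap γ η
          (P.iter γ η o (fun s => π s ω) (fun s => πh s ω) w₀ t)‖ ^ 2 ∂ρ ≤ ε ^ 2) := by
  have R : P.Regular μh Mh σJ γ MF LF := ⟨hn, hP, hb, hγ, hμγ⟩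
  have hn' : (0 : ℝ) < n := Nat.cast_pos.2 hn
  have hC : 0 ≤ Mh ^ 2 * ‖P.K‖ ^ 2 * σJ ^ 2 := by positivity
  have hCe : (‖P.K‖ * Mh) ^ 2 * σJ ^ 2 = Mh ^ 2 * ‖P.K‖ ^ 2 * σJ ^ 2 := by ring
  set Q := P.Q μh Mh γ MF LF with hQdef
  set C := Mh ^ 2 * ‖P.K‖ ^ 2 * σJ ^ 2 with hCdef
  have hC4 : 4 * Mh ^ 2 * ‖P.K‖ ^ 2 * σJ ^ 2 = 4 * C := by rw [hCdef]; ring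
  rw [hC4] at hD ⊢
  constructor
  · intro η T π πh hη hηle hG hT
    have hr : 0 < √(4 * C + Λ1) := Real.sqrt_pos.2 hD
    have hr2 : √(4 * C + Λ1) ^ 2 = 4 * C + Λ1 := Real.sq_sqrt hD.le
    set r := √(4 * C + Λ1) with hrdef
    have hη0 : 0 < η := by rw [hη]; positivity
    -- The strict bound `x < ⌊x⌋₊ + 1` explains the floor: the average runs over `T + 1` iterates.
    have hT' := (Nat.lt_floor_add_one _).trans_le (add_le_add_left (Nat.cast_le (α := ℝ).2 hT) 1)
    have hsum := R.sum_gradMap_le o hη0 hΛ0 hΛ1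
      (NLShuffle.step_size_sq_le hη0 hQ hΛ0 hηle) hG π πh hw₀ (T + 1)
    refine NLShuffle.average_le_of_sum_le (Q := Q) (D := 64 * Q * r / ε ^ 3)
      (Δ := (P.Psi0 w₀).toReal - P.Psi0Star.toReal + γ * P.oscB) (V := 3 * (C / 2) + Λ1)
      hη0 hε ?_ (lt_of_eq_of_lt (by ring) hT') ?_ (hsum.trans ?_)
    · have h1 : η ^ 2 * Q ^ 2 = ε ^ 2 / 64 / r ^ 2 := by
        rw [hη]; field_simp; norm_num
      rw [h1, hr2, mul_div_assoc', div_mul_eq_mul_div, div_le_iff₀ hD]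
      nlinarith [mul_nonneg (sq_nonneg ε) hC, mul_nonneg (sq_nonneg ε) hΛ1]
    · rw [hη]; field_simp; norm_num
    · refine add_le_add_right (mul_le_mul_of_nonneg_left ?_ (by positivity)) _
      refine (Finset.sum_le_card_nsmul _ _ (3 * (C / 2) + Λ1) fun t _ => ?_).trans (le_of_eq ?_)
      · have := R.partialSumSq_gradDev_le (P.iter γ η o π πh w₀ t) (πh t)
        rw [hCe] at this
        linarith
      · rw [Finset.card_range, nsmul_eq_mul, Nat.cast_add_one]
  · intro η T Ω _ ρ _ π πh hsh hη hηle hG hT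
    refine ⟨fun t => NLShuffle.Data.integrable_comp_iter hsh η o w₀ t
      fun w => ‖P.gradMap γ η w‖ ^ 2, ?_⟩
    have hs : 0 < √(n : ℝ) := Real.sqrt_pos.2 hn'
    have hs2 : √(n : ℝ) ^ 2 = n := Real.sq_sqrt hn'.le
    have hn1 : (1 : ℝ) ≤ n := Nat.one_le_cast.2 hn
    -- Positivity passes from `4 C + Λ₁` because `n ≥ 1`.
    have hDn : 0 < 4 * C + n * Λ1 := by nlinarith
    have hr : 0 < √(4 * C + n * Λ1) := Real.sqrt_pos.2 hDn
    have hr2 : √(4 * C + n * Λ1) ^ 2 = 4 * C + n * Λ1 := Real.sq_sqrt hDn.le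
    set r := √(4 * C + n * Λ1) with hrdef
    set s := √(n : ℝ) with hsdef
    have hη0 : 0 < η := by rw [hη]; positivity
    have hT' := (Nat.lt_floor_add_one _).trans_le (add_le_add_left (Nat.cast_le (α := ℝ).2 hT) 1)
    have hint1 := fun t => NLShuffle.Data.integrable_comp_iter (P := P) (γ := γ) hsh η o w₀ t
      fun w => ‖P.gradMap γ η w‖ ^ 2
    have hint2 : ∀ t, Integrable (fun ω => 3 * NLShuffle.partialSumSq (P.gradDev γ
        (P.iter γ η o (fun s => π s ω) (fun s => πh s ω) w₀ t)) (πh t ω) + Λ1) ρ := fun t =>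
      ((NLShuffle.Data.integrable_partialSumSq (P := P) (γ := γ) hsh η o w₀ t).const_mul 3).add
        (integrable_const Λ1)
    -- The summed inequality holds for every `ω`, so it is integrated as a whole.
    have hsum := integral_mono (μ := ρ)
      ((integrable_finsetSum (Finset.range (T + 1)) fun t _ => hint1 t).const_mul (η / 4))
      ((integrable_const _).add ((integrable_finsetSum (Finset.range (T + 1))
        fun t _ => hint2 t).const_mul (η * (η ^ 2 * Q ^ 2))))
      fun ω => R.sum_gradMap_le o hη0 hΛ0 hΛ1
        (NLShuffle.step_size_sq_le hη0 hQ hΛ0 hηle) hG (fun s => π s ω) (fun s => πh s ω) hw₀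
        (T + 1)
    simp only [Pi.add_apply] at hsum
    rw [integral_const_mul, integral_finsetSum _ fun t _ => hint1 t,
      integral_add (integrable_const _) ((integrable_finsetSum (Finset.range (T + 1))
        fun t _ => hint2 t).const_mul (η * (η ^ 2 * Q ^ 2))), integral_const_mul,
      integral_finsetSum _ fun t _ => hint2 t, integral_const, probReal_univ, one_smul] at hsum
    refine NLShuffle.average_le_of_sum_le (Q := Q) (D := 64 * Q * r / (s * ε ^ 3))
      (Δ := (P.Psi0 w₀).toReal - P.Psi0Star.toReal + γ * P.oscB)
      (V := 3 * (C / (2 * n)) + Λ1)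
      hη0 hε ?_ (lt_of_eq_of_lt (by ring) hT') ?_ (hsum.trans ?_)
    · have h1 : η ^ 2 * Q ^ 2 = n * ε ^ 2 / 64 / r ^ 2 := by
        rw [hη, ← hs2]; field_simp; norm_num
      -- The factor `n` in `η²` cancels the `1/n` gained in the variance and turns `Λ₁` into `n Λ₁`.
      have h2 : 4 * (n * ε ^ 2 / 64 / r ^ 2) * (3 * (C / (2 * n)) + Λ1)
          = ε ^ 2 / 16 * (3 * C / 2 + n * Λ1) / r ^ 2 := by
        field_simp; ring
      rw [h1, h2, hr2, div_le_iff₀ hDn]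
      nlinarith [mul_nonneg (sq_nonneg ε) hC, mul_nonneg (sq_nonneg ε) (mul_nonneg hn'.le hΛ1)]
    · rw [hη]; field_simp; norm_num
    · refine add_le_add_right (mul_le_mul_of_nonneg_left ?_ (by positivity)) _
      refine (Finset.sum_le_card_nsmul _ _ (3 * (C / (2 * n)) + Λ1) fun t _ => ?_).trans
        (le_of_eq ?_)
      · have h1 := R.integral_partialSumSq_le hsh η o w₀ t
        rw [hCe] at h1
        rw [integral_add ((NLShuffle.Data.integrable_partialSumSq hsh η o w₀ t).const_mul 3)
          (integrable_const _), integral_const_mul, integral_const, probReal_univ, one_smul]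
        linarith
      · rw [Finset.card_range, nsmul_eq_mul, Nat.cast_add_one]
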